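/- Define functions $h_J$ of $1+J$ real variables recursively by $h_0(\eta)=1$ and, for $J\ge 1$, $$h_J(\eta;\phi_1,\dots,\phi_J)=\frac{1}{\eta-\phi_1-\dots-\phi_J}\sum_{j=0}^{J-1}h_j(\eta;\phi_1,\dots,\phi_j)\,h_{J-j-1}(\eta;\phi_{j+1},\dots,\phi_{J-1}).$$ Let $V:(0,\infty)\to\mathbb R$ be given, for every $x>0$, by $$V(x)=\sum_{k=1}^\infty c_k e^{-i\phi_k x}\gamma_k(x)$$ with $c_k\in\mathbb C$, $\phi_k\in\mathbb R$ and $\gamma_k:(0,\infty)\to\mathbb C$. Let $\eta\in(0,\infty)$ and let $p\ge 2$ be an integer, so that the following conditions hold: (i) $\sup_k \operatorname{Var}(\gamma_k,(0,\infty))<\infty$, where $\operatorname{Var}(\gamma,I)$ denotes the total variation of $\gamma$ on $I$; (ii) $\int_0^\infty\bigl(\sup_k|\gamma_k(x)|\bigr)^p\,dx<\infty$; (iii) $\sum_{k=1}^\infty|c_k|<\infty$; (iv) for every $j=1,\dots,p-1$, one has $\eta\ne\phi_{k_1}+\dots+\phi_{k_j}$ for all $k_1,\dots,k_j\ge 1$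 with $c_{k_1}\cdots c_{k_j}\ne 0$ (so that the expressions below are defined), and $$\sum_{k_1,\dots,k_j=1}^\infty\bigl|c_{k_1}\cdots c_{k_j}\,h_j(\eta;\phi_{k_1},\dots,\phi_{k_j})\bigr|<\infty,$$ where terms with $c_{k_1}\cdots c_{k_j}=0$ are counted as $0$. Then, for $E=\eta^2/4$, every solution $u$ of $$-u''(x)+V(x)u(x)=Eu(x),\qquad x\in(0,\infty),$$ is bounded on $(0,\infty)$. Here a solution is a function $u:(0,\infty)\to\mathbb C$ such that $u$ is differentiable, $u$ and $u'$ are locally absolutely continuous, and the equation holds for almost every $x$. -/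

import Mathlib

open Set MeasureTheory
open scoped ENNReal

/-- The functions `h_J(η; φ_1, …, φ_J)`: `h_0 = 1` and
`h_J(η; φ_1, …, φ_J) = (η - φ_1 - ⋯ - φ_J)⁻¹ *
  ∑_{j=0}^{J-1} h_j(η; φ_1, …, φ_j) * h_{J-j-1}(η; φ_{j+1}, …, φ_{J-1})`,
written here with `J + 1` in place of `J` and with the arguments numbered from `0`.
The value is meaningful only when no divisor that enters the recursion vanishes. -/
noncomputable def smallDivisorH (η : ℝ) : (J : ℕ) → (Fin J → ℝ) → ℝ
  | 0, _ => 1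
  | J + 1, φ =>
      1 / (η - ∑ i, φ i) *
        ∑ j : Fin (J + 1),
          smallDivisorH η j.1 (fun i => φ ⟨i.1, by omega⟩) *
            smallDivisorH η (J - j.1) (fun i => φ ⟨j.1 + i.1, by omega⟩)
termination_by J => J
decreasing_by all_goals omega

/-- The small divisor condition of order `j` at `η`, for the coefficients `c_k` and the
frequencies `φ_k`: the series `∑_{k_1, …, k_j} |c_{k_1} ⋯ c_{k_j} h_j(η; φ_{k_1}, …, φ_{k_j})|`
converges. Its terms have to make sense: the divisor `η - φ_{k_1} - ⋯ - φ_{k_j}` must not vanish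
when all of `c_{k_1}, …, c_{k_j}` are nonzero (a term with a vanishing coefficient counts as `0`).
The other divisors in `h_j` belong to shorter blocks of `k_1, …, k_j`, and so to
the conditions of lower order. -/
def SmallDivisorCondition (c : ℕ → ℂ) (φ : ℕ → ℝ) (η : ℝ) (j : ℕ) : Prop :=
  (∀ k : Fin j → ℕ, (∀ i, c (k i) ≠ 0) → η - ∑ i, φ (k i) ≠ 0) ∧
    Summable fun k : Fin j → ℕ =>
      ‖(∏ i, c (k i)) * (smallDivisorH η j (fun i => φ (k i)) : ℂ)‖

/-- `f` is locally absolutely continuous on `(0, ∞)`: it is absolutely continuous on every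
compact subinterval `[a, b]` of `(0, ∞)`. -/
def LocallyAC (f : ℝ → ℂ) : Prop :=
  ∀ a b : ℝ, 0 < a → a ≤ b → AbsolutelyContinuousOnInterval f a b

/-- `u` solves `-u'' + V u = E u` on `(0, ∞)`: `u` is differentiable on `(0, ∞)`, `u` and `u'` are
locally absolutely continuous there, and the equation holds almost everywhere. -/
structure IsSchrodingerSolution (V : ℝ → ℝ) (E : ℝ) (u : ℝ → ℂ) : Prop where
  differentiableAt : ∀ x : ℝ, 0 < x → DifferentiableAt ℝ u x
  locallyAC : LocallyAC u
  locallyAC_deriv : LocallyAC (deriv u)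
  equation : ∀ᵐ x ∂(volume.restrict (Ioi (0 : ℝ))),
    DifferentiableAt ℝ (deriv u) x ∧
      -(deriv (deriv u) x) + (V x : ℂ) * u x = (E : ℂ) * u x

/-!
The amplitudes `a = u' + iηu/2` and `b = u' - iηu/2` of a solution satisfy a first order system
with coefficient `v = V/η`, which any solution `r` of the Riccati equation `r' = -iηr + iv(1 + r)²`
diagonalizes. If `‖r‖ ≤ 1/2` and `r` solves that equation up to an error `g`, then a quadratic
form `E` in `(a, b)`, comparable to `‖u‖² + ‖u'‖²`, satisfies `|E'| ≤ 6gE`. So it is enough to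
find approximate solutions that tend to `0` and have a summable error.

With `z_k = η⁻¹ c_k e^{-iφ_k x} γ_k(x)`, so that `v = ∑ z_k`, consider the series
`S_J = ∑ z_{k_1} ⋯ z_{k_J} h_J(η; φ_{k_1}, …, φ_{k_J})`. They solve the Riccati equation order by
order: by the recursion for `h_J`, `S_J' + iηS_J = iv ∑_{j < J} S_j S_{J-1-j}`, up to terms with a
derivative of some `γ_k`. Hence `r = S_1 + ⋯ + S_{p-1}` leaves an error made of terms of degree at
least `p` in the `γ_k`, summable by the `L^p` condition, and of terms with a derivative of some
`γ_k`, summable by the bounded variation. As the `γ_k` need not be differentiable, each of them is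
replaced on `[n + 1, n + 2]` by its affine interpolation.
-/

/-- The reindexing of `(k_1, …, k_m, k_{m+1}, …, k_{m+n}, k_{m+n+1})` as a triple of blocks. -/
def splitLastEquiv (ι : Type*) (m n : ℕ) :
    (Fin (m + n + 1) → ι) ≃ ((Fin m → ι) × (Fin n → ι)) × ι :=
  (Fin.succFunEquiv ι (m + n)).trans
    (Equiv.prodCongr (Fin.appendEquiv m n).symm (Equiv.refl ι))

section SmallDivisorSeries

variable {ι : Type*}

theorem summable_norm_mul_blocks {m n J : ℕ} (hJ : J = m + n) {f : (Fin m → ι) → ℂ}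
    {g : (Fin n → ι) → ℂ} {w : ι → ℂ} (hf : Summable fun k => ‖f k‖)
    (hg : Summable fun k => ‖g k‖) (hw : Summable fun k => ‖w k‖) :
    Summable fun k : Fin (J + 1) → ι =>
      ‖f (fun i => k ⟨i.1, by omega⟩) * g (fun i => k ⟨m + i.1, by omega⟩) *
        w (k (Fin.last J))‖ := by
  subst hJ
  exact (splitLastEquiv ι m n).summable_iff.2 ((hf.mul_norm hg).mul_norm hw)

theorem tsum_mul_blocks {m n J : ℕ} (hJ : J = m + n) {f : (Fin m → ι) → ℂ}
    {g : (Fin n → ι) → ℂ} {w : ι → ℂ} (hf : Summable fun k => ‖f k‖)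
    (hg : Summable fun k => ‖g k‖) (hw : Summable fun k => ‖w k‖) :
    ∑' k : Fin (J + 1) → ι,
      f (fun i => k ⟨i.1, by omega⟩) * g (fun i => k ⟨m + i.1, by omega⟩) *
        w (k (Fin.last J)) = (∑' k, f k) * (∑' k, g k) * ∑' k, w k := by
  subst hJ
  rw [tsum_mul_tsum_of_summable_norm hf hg, tsum_mul_tsum_of_summable_norm (hf.mul_norm hg) hw,
    ← (splitLastEquiv ι m n).tsum_eq]
  rfl

theorem prod_eq_prod_blocks {m n J : ℕ} (hJ : J = m + n) (z : Fin (J + 1) → ℂ) :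
    ∏ i, z i = (∏ i : Fin m, z ⟨i.1, by omega⟩) * (∏ i : Fin n, z ⟨m + i.1, by omega⟩) *
      z (Fin.last J) := by
  subst hJ
  rw [Fin.prod_univ_castSucc, Fin.prod_univ_add]
  rfl

theorem divisor_mul_smallDivisorH (η : ℝ) (J : ℕ) (φ : Fin (J + 1) → ℝ)
    (h : η - ∑ i, φ i ≠ 0) :
    (η - ∑ i, φ i) * smallDivisorH η (J + 1) φ =
      ∑ j : Fin (J + 1), smallDivisorH η j.1 (fun i => φ ⟨i.1, by omega⟩) *
        smallDivisorH η (J - j.1) (fun i => φ ⟨j.1 + i.1, by omega⟩) := by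
  rw [smallDivisorH, ← mul_assoc, mul_one_div_cancel h, one_mul]

/-- The term `z_{k_1} ⋯ z_{k_J} h_J(η; φ_{k_1}, …, φ_{k_J})`. -/
noncomputable def smallDivisorTerm (η : ℝ) (φ : ι → ℝ) (z : ι → ℂ) (J : ℕ) (k : Fin J → ι) : ℂ :=
  (∏ i, z (k i)) * (smallDivisorH η J (fun i => φ (k i)) : ℂ)

/-- The series `∑ z_{k_1} ⋯ z_{k_J} h_J(η; φ_{k_1}, …, φ_{k_J})`. -/
noncomputable def smallDivisorSum (η : ℝ) (φ : ι → ℝ) (z : ι → ℂ) (J : ℕ) : ℂ :=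
  ∑' k, smallDivisorTerm η φ z J k

/-- The derivative of `smallDivisorTerm` with respect to `z`, in the direction `w`. -/
noncomputable def smallDivisorTermDeriv (η : ℝ) (φ : ι → ℝ) (z w : ι → ℂ) (J : ℕ)
    (k : Fin J → ι) : ℂ :=
  (∑ i, (∏ j ∈ Finset.univ.erase i, z (k j)) * w (k i)) * (smallDivisorH η J (fun i => φ (k i)) : ℂ)

/-- The derivative of `smallDivisorSum` with respect to `z`, in the direction `w`. -/
noncomputable def smallDivisorSumDeriv (η : ℝ) (φ : ι → ℝ) (z w : ι → ℂ) (J : ℕ) : ℂ :=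
  ∑' k, smallDivisorTermDeriv η φ z w J k

variable {η : ℝ} {φ : ι → ℝ} {c z w : ι → ℂ}

theorem smallDivisorSum_zero (η : ℝ) (φ : ι → ℝ) (z : ι → ℂ) : smallDivisorSum η φ z 0 = 1 := by
  rw [smallDivisorSum, tsum_fintype]
  simp [smallDivisorTerm, smallDivisorH]

theorem divisor_mul_smallDivisorTerm {J : ℕ} {k : Fin (J + 1) → ι}
    (hne : (∀ i, z (k i) ≠ 0) → η - ∑ i, φ (k i) ≠ 0) :
    ((η - ∑ i, φ (k i) : ℝ) : ℂ) * smallDivisorTerm η φ z (J + 1) k =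
      ∑ j : Fin (J + 1), smallDivisorTerm η φ z j.1 (fun i => k ⟨i.1, by omega⟩) *
        smallDivisorTerm η φ z (J - j.1) (fun i => k ⟨j.1 + i.1, by omega⟩) *
          z (k (Fin.last J)) := by
  have factor : ∀ j : Fin (J + 1), smallDivisorTerm η φ z j.1 (fun i => k ⟨i.1, by omega⟩) *
        smallDivisorTerm η φ z (J - j.1) (fun i => k ⟨j.1 + i.1, by omega⟩) *
          z (k (Fin.last J)) = (∏ i, z (k i)) *
        ((smallDivisorH η j.1 (fun i => φ (k ⟨i.1, by omega⟩)) *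
        smallDivisorH η (J - j.1) (fun i => φ (k ⟨j.1 + i.1, by omega⟩)) : ℝ) : ℂ) := by
    intro j
    rw [prod_eq_prod_blocks (m := j.1) (n := J - j.1) (by omega) (fun i => z (k i))]
    simp only [smallDivisorTerm]
    push_cast
    ring
  rw [Finset.sum_congr rfl fun j _ => factor j, ← Finset.mul_sum, smallDivisorTerm, mul_left_comm]
  by_cases h : ∀ i, z (k i) ≠ 0
  · rw [← Complex.ofReal_mul, divisor_mul_smallDivisorH η J (fun i => φ (k i)) (hne h),
      Complex.ofReal_sum]
  · obtain ⟨i, hi⟩ := not_forall_not.1 h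
    rw [Finset.prod_eq_zero (Finset.mem_univ i) hi, zero_mul, zero_mul]

theorem summable_norm_divisor_mul_smallDivisorTerm {J : ℕ}
    (hne : ∀ k : Fin (J + 1) → ι, (∀ i, z (k i) ≠ 0) → η - ∑ i, φ (k i) ≠ 0)
    (hz : Summable fun k => ‖z k‖)
    (hterm : ∀ j ≤ J, Summable fun k => ‖smallDivisorTerm η φ z j k‖) :
    Summable fun k : Fin (J + 1) → ι =>
      ‖((η - ∑ i, φ (k i) : ℝ) : ℂ) * smallDivisorTerm η φ z (J + 1) k‖ := by
  simp only [divisor_mul_smallDivisorTerm (hne _)]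
  refine .of_nonneg_of_le (fun _ => norm_nonneg _) (fun k => norm_sum_le _ _)
    (summable_sum fun j _ => ?_)
  exact summable_norm_mul_blocks (by omega) (hterm j.1 (by omega)) (hterm (J - j.1) (by omega)) hz

theorem tsum_divisor_mul_smallDivisorTerm {J : ℕ}
    (hne : ∀ k : Fin (J + 1) → ι, (∀ i, z (k i) ≠ 0) → η - ∑ i, φ (k i) ≠ 0)
    (hz : Summable fun k => ‖z k‖)
    (hterm : ∀ j ≤ J, Summable fun k => ‖smallDivisorTerm η φ z j k‖) :
    ∑' k : Fin (J + 1) → ι, ((η - ∑ i, φ (k i) : ℝ) : ℂ) * smallDivisorTerm η φ z (J + 1) k =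
      (∑' k, z k) * ∑ j ∈ Finset.range (J + 1),
        smallDivisorSum η φ z j * smallDivisorSum η φ z (J - j) := by
  simp only [divisor_mul_smallDivisorTerm (hne _)]
  rw [Summable.tsum_finsetSum fun j _ => (summable_norm_mul_blocks (by omega)
    (hterm j.1 (by omega)) (hterm (J - j.1) (by omega)) hz).of_norm, Finset.sum_range,
    Finset.mul_sum]
  refine Finset.sum_congr rfl fun j _ => ?_
  rw [tsum_mul_blocks (by omega) (hterm j.1 (by omega)) (hterm (J - j.1) (by omega)) hz, mul_comm]
  rfl

theorem norm_smallDivisorTerm_le_mul_prod {b : ι → ℝ} (hz : ∀ k, ‖z k‖ ≤ ‖c k‖ * b k) (J : ℕ)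
    (k : Fin J → ι) :
    ‖smallDivisorTerm η φ z J k‖ ≤ ‖smallDivisorTerm η φ c J k‖ * ∏ i, b (k i) := by
  rw [smallDivisorTerm, smallDivisorTerm, norm_mul, norm_mul, norm_prod, norm_prod]
  calc (∏ i, ‖z (k i)‖) * ‖(smallDivisorH η J (fun i => φ (k i)) : ℂ)‖
      ≤ (∏ i, (‖c (k i)‖ * b (k i))) * ‖(smallDivisorH η J (fun i => φ (k i)) : ℂ)‖ := by
        gcongr with i
        exact hz _
    _ = _ := by rw [Finset.prod_mul_distrib, mul_right_comm]

theorem norm_smallDivisorTerm_le {B : ℝ} (hz : ∀ k, ‖z k‖ ≤ ‖c k‖ * B) (J : ℕ) (k : Fin J → ι) :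
    ‖smallDivisorTerm η φ z J k‖ ≤ ‖smallDivisorTerm η φ c J k‖ * B ^ J := by
  simpa using norm_smallDivisorTerm_le_mul_prod (b := fun _ => B) hz J k

theorem norm_smallDivisorTermDeriv_le {B : ℝ} {d : ι → ℝ} (hz : ∀ k, ‖z k‖ ≤ ‖c k‖ * B)
    (hw : ∀ k, ‖w k‖ ≤ ‖c k‖ * d k) (J : ℕ) (k : Fin J → ι) :
    ‖smallDivisorTermDeriv η φ z w J k‖ ≤
      ‖smallDivisorTerm η φ c J k‖ * (B ^ (J - 1) * ∑ i, d (k i)) := by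
  have norm_summand_le (i : Fin J) : ‖(∏ j ∈ Finset.univ.erase i, z (k j)) * w (k i)‖ ≤
      (∏ i, ‖c (k i)‖) * (B ^ (J - 1) * d (k i)) := by
    rw [norm_mul, norm_prod]
    calc (∏ j ∈ Finset.univ.erase i, ‖z (k j)‖) * ‖w (k i)‖
        ≤ (∏ j ∈ Finset.univ.erase i, (‖c (k j)‖ * B)) * (‖c (k i)‖ * d (k i)) := by
          refine mul_le_mul (Finset.prod_le_prod (fun _ _ => norm_nonneg _) fun j _ => hz _) (hw _)
            (norm_nonneg _) (Finset.prod_nonneg fun j _ => (norm_nonneg _).trans (hz _))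
      _ = (∏ i, ‖c (k i)‖) * (B ^ (J - 1) * d (k i)) := by
          rw [Finset.prod_mul_distrib, Finset.prod_const,
            Finset.card_erase_of_mem (Finset.mem_univ i), Finset.card_fin,
            ← Finset.mul_prod_erase Finset.univ (fun i => ‖c (k i)‖) (Finset.mem_univ i)]
          ring
  rw [smallDivisorTermDeriv, smallDivisorTerm, norm_mul, norm_mul, norm_prod]
  calc _ ≤ (∑ i, (∏ i, ‖c (k i)‖) * (B ^ (J - 1) * d (k i))) *
        ‖(smallDivisorH η J (fun i => φ (k i)) : ℂ)‖ := by
        gcongr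
        exact (norm_sum_le _ _).trans (Finset.sum_le_sum fun i _ => norm_summand_le i)
    _ = _ := by
        rw [← Finset.mul_sum, ← Finset.mul_sum]
        ring

theorem hasDerivAt_smallDivisorTerm {z : ℝ → ι → ℂ} {x : ℝ}
    (hz : ∀ k, HasDerivAt (fun x => z x k) (-Complex.I * φ k * z x k + w k) x) (J : ℕ)
    (k : Fin J → ι) :
    HasDerivAt (fun x => smallDivisorTerm η φ (z x) J k)
      (-Complex.I * η * smallDivisorTerm η φ (z x) J k +
        Complex.I * (((η - ∑ i, φ (k i) : ℝ) : ℂ) * smallDivisorTerm η φ (z x) J k) +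
        smallDivisorTermDeriv η φ (z x) w J k) x := by
  refine ((HasDerivAt.fun_finsetProd (u := Finset.univ) fun i _ => hz (k i)).mul_const
    (smallDivisorH η J (fun i => φ (k i)) : ℂ)).congr_deriv ?_
  have deriv_prod : ∑ i : Fin J, (∏ j ∈ Finset.univ.erase i, z x (k j)) •
        (-Complex.I * φ (k i) * z x (k i) + w (k i)) =
      -Complex.I * ((∑ i, φ (k i) : ℝ) : ℂ) * ∏ i, z x (k i) +
      ∑ i : Fin J, (∏ j ∈ Finset.univ.erase i, z x (k j)) * w (k i) := by
    push_cast
    rw [Finset.mul_sum, Finset.sum_mul, ← Finset.sum_add_distrib]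
    refine Finset.sum_congr rfl fun i hi => ?_
    rw [← Finset.mul_prod_erase Finset.univ _ hi, smul_eq_mul]
    ring
  rw [deriv_prod]
  simp only [smallDivisorTerm, smallDivisorTermDeriv]
  push_cast
  ring

theorem hasDerivAt_smallDivisorSum_tsum {z w : ℝ → ι → ℂ} {B : ℝ} {J : ℕ} {s : Set ℝ}
    (hs : IsOpen s) (hs' : IsPreconnected s)
    (hterm : Summable fun k => ‖smallDivisorTerm η φ c J k‖)
    (hdiv : Summable fun k : Fin J → ι =>
      ‖((η - ∑ i, φ (k i) : ℝ) : ℂ) * smallDivisorTerm η φ c J k‖)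
    (hz : ∀ x ∈ s, ∀ k, HasDerivAt (fun x => z x k) (-Complex.I * φ k * z x k + w x k) x)
    (hzB : ∀ x ∈ s, ∀ k, ‖z x k‖ ≤ ‖c k‖ * B) (hwB : ∀ x ∈ s, ∀ k, ‖w x k‖ ≤ ‖c k‖ * B)
    {x : ℝ} (hx : x ∈ s) :
    HasDerivAt (fun x => smallDivisorSum η φ (z x) J)
      (∑' k : Fin J → ι, (-Complex.I * η * smallDivisorTerm η φ (z x) J k +
        Complex.I * (((η - ∑ i, φ (k i) : ℝ) : ℂ) * smallDivisorTerm η φ (z x) J k) +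
        smallDivisorTermDeriv η φ (z x) (w x) J k)) x := by
  have norm_deriv_le (k : Fin J → ι) (y : ℝ) (hy : y ∈ s) :
      ‖-Complex.I * η * smallDivisorTerm η φ (z y) J k +
        Complex.I * (((η - ∑ i, φ (k i) : ℝ) : ℂ) * smallDivisorTerm η φ (z y) J k) +
        smallDivisorTermDeriv η φ (z y) (w y) J k‖ ≤
      |η| * (‖smallDivisorTerm η φ c J k‖ * B ^ J) +
        ‖((η - ∑ i, φ (k i) : ℝ) : ℂ) * smallDivisorTerm η φ c J k‖ * B ^ J +
        ‖smallDivisorTerm η φ c J k‖ * (B ^ (J - 1) * ∑ _i : Fin J, B) := by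
    refine norm_add₃_le.trans (add_le_add (add_le_add ?_ ?_)
      (norm_smallDivisorTermDeriv_le (hzB y hy) (hwB y hy) _ _))
    · rw [norm_mul, norm_mul, norm_neg, Complex.norm_I, one_mul, Complex.norm_real,
        Real.norm_eq_abs]
      gcongr
      exact norm_smallDivisorTerm_le (hzB y hy) _ _
    · rw [norm_mul, Complex.norm_I, one_mul, norm_mul, norm_mul, mul_assoc]
      gcongr
      exact norm_smallDivisorTerm_le (hzB y hy) _ _
  exact hasDerivAt_tsum_of_isPreconnected (𝕜 := ℝ)
    ((((hterm.mul_right _).mul_left _).add (hdiv.mul_right _)).add (hterm.mul_right _)) hs hs'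
    (fun k y hy => hasDerivAt_smallDivisorTerm (hz y hy) J k) norm_deriv_le hx
    (Summable.of_norm_bounded (hterm.mul_right _) (norm_smallDivisorTerm_le (hzB x hx) J)) hx

/-- Differentiating `e^{-iφx}` produces the divisor `η - φ_{k_1} - ⋯ - φ_{k_J}` up to the common
term `-iη`, and the recursion for `h_J` turns it into a convolution. -/
theorem hasDerivAt_smallDivisorSum {z w : ℝ → ι → ℂ} {B : ℝ} {J : ℕ} {s : Set ℝ}
    (hs : IsOpen s) (hs' : IsPreconnected s)
    (hne : ∀ k : Fin (J + 1) → ι, (∀ i, c (k i) ≠ 0) → η - ∑ i, φ (k i) ≠ 0)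
    (hc : Summable fun k => ‖c k‖)
    (hterm : ∀ j ≤ J + 1, Summable fun k => ‖smallDivisorTerm η φ c j k‖)
    (hz : ∀ x ∈ s, ∀ k, HasDerivAt (fun x => z x k) (-Complex.I * φ k * z x k + w x k) x)
    (hzB : ∀ x ∈ s, ∀ k, ‖z x k‖ ≤ ‖c k‖ * B) (hwB : ∀ x ∈ s, ∀ k, ‖w x k‖ ≤ ‖c k‖ * B)
    {x : ℝ} (hx : x ∈ s) :
    HasDerivAt (fun x => smallDivisorSum η φ (z x) (J + 1))
      (-Complex.I * η * smallDivisorSum η φ (z x) (J + 1) +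
        Complex.I * ((∑' k, z x k) * ∑ j ∈ Finset.range (J + 1),
          smallDivisorSum η φ (z x) j * smallDivisorSum η φ (z x) (J - j)) +
        smallDivisorSumDeriv η φ (z x) (w x) (J + 1)) x := by
  have hzne (k : Fin (J + 1) → ι) (hk : ∀ i, z x (k i) ≠ 0) : η - ∑ i, φ (k i) ≠ 0 :=
    hne k fun i hi => hk i <| norm_le_zero_iff.1 <| (hzB x hx _).trans_eq <| by simp [hi]
  have hzsum : Summable fun k => ‖z x k‖ :=
    .of_nonneg_of_le (fun _ => norm_nonneg _) (hzB x hx) (hc.mul_right _)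
  have hzterm (j : ℕ) (hj : j ≤ J + 1) : Summable fun k => ‖smallDivisorTerm η φ (z x) j k‖ :=
    .of_nonneg_of_le (fun _ => norm_nonneg _) (norm_smallDivisorTerm_le (hzB x hx) j)
      ((hterm j hj).mul_right _)
  have hdiv := summable_norm_divisor_mul_smallDivisorTerm hne hc fun j hj => hterm j (by omega)
  have hzdiv := summable_norm_divisor_mul_smallDivisorTerm hzne hzsum
    fun j hj => hzterm j (by omega)
  have hD := Summable.of_norm_bounded ((hterm _ le_rfl).mul_right _)
    (norm_smallDivisorTermDeriv_le (η := η) (φ := φ) (hzB x hx) (hwB x hx) (J + 1))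
  refine (hasDerivAt_smallDivisorSum_tsum hs hs' (hterm _ le_rfl) hdiv hz hzB hwB hx).congr_deriv ?_
  have hη := (hzterm _ le_rfl).of_norm.mul_left (-Complex.I * η)
  have hI := hzdiv.of_norm.mul_left Complex.I
  rw [(hη.add hI).tsum_add hD, hη.tsum_add hI, tsum_mul_left, tsum_mul_left,
    tsum_divisor_mul_smallDivisorTerm hzne hzsum fun j hj => hzterm j (by omega),
    smallDivisorSum, smallDivisorSumDeriv]

end SmallDivisorSeries

/-- The Riccati vector field `r ↦ -iηr + iv(1 + r)²`; its solutions remove the term that couples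
the amplitudes `u' + iηu/2` and `u' - iηu/2` of a solution of `-u'' + ηvu = (η²/4)u`. -/
noncomputable def riccatiField (η v : ℝ) (r : ℂ) : ℂ :=
  -Complex.I * η * r + Complex.I * v * (1 + r) ^ 2

theorem sq_sum_range_succ (X : ℕ → ℂ) (q : ℕ) :
    (∑ j ∈ Finset.range (q + 1), X j) ^ 2 =
      ∑ J ∈ Finset.range q, ∑ j ∈ Finset.range (J + 1), X j * X (J - j) +
        ∑ ij ∈ (Finset.range (q + 1) ×ˢ Finset.range (q + 1)).filter (fun ij => q ≤ ij.1 + ij.2),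
          X ij.1 * X ij.2 := by
  rw [sq, Finset.sum_mul_sum, ← Finset.sum_product',
    ← Finset.sum_filter_not_add_sum_filter _ (fun ij : ℕ × ℕ => q ≤ ij.1 + ij.2)]
  congr 1
  rw [Finset.sum_sigma']
  refine (Finset.sum_nbij' (fun a => (a.2, a.1 - a.2)) (fun ij => ⟨ij.1 + ij.2, ij.1⟩)
    ?_ ?_ ?_ ?_ ?_).symm
  · rintro ⟨a, b⟩ h
    simp only [Finset.mem_sigma, Finset.mem_range] at h
    simp only [Finset.mem_filter, Finset.mem_product, Finset.mem_range]
    omega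
  · rintro ⟨a, b⟩ h
    simp only [Finset.mem_filter, Finset.mem_product, Finset.mem_range] at h
    simp only [Finset.mem_sigma, Finset.mem_range]
    omega
  · rintro ⟨a, b⟩ h
    simp only [Finset.mem_sigma, Finset.mem_range] at h
    simp only [Sigma.mk.injEq, heq_eq_eq, and_true]
    omega
  · rintro ⟨a, b⟩ -
    exact Prod.ext rfl (Nat.add_sub_cancel_left a b)
  · rintro ⟨a, b⟩ -
    rfl

section RiccatiSum

variable {ι : Type*}

/-- The partial sum `∑_{1 ≤ J ≤ q}` of the series `smallDivisorSum`, an approximate solution of the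
Riccati equation. -/
noncomputable def riccatiSum (η : ℝ) (φ : ι → ℝ) (z : ι → ℂ) (q : ℕ) : ℂ :=
  ∑ j ∈ Finset.range q, smallDivisorSum η φ z (j + 1)

/-- The error with which `riccatiSum` solves the Riccati equation for the potential `v`, when `w`
collects the derivatives of the amplitudes. -/
noncomputable def riccatiDefect (η : ℝ) (φ : ι → ℝ) (z w : ι → ℂ) (q : ℕ) (v : ℝ) : ℂ :=
  ∑ j ∈ Finset.range q, smallDivisorSumDeriv η φ z w (j + 1) -
    Complex.I * (∑' k, z k) *
      ∑ ij ∈ (Finset.range (q + 1) ×ˢ Finset.range (q + 1)).filter (fun ij => q ≤ ij.1 + ij.2),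
        smallDivisorSum η φ z ij.1 * smallDivisorSum η φ z ij.2 +
    Complex.I * (∑' k, z k - v) * (1 + riccatiSum η φ z q) ^ 2

variable {η : ℝ} {φ : ι → ℝ} {c : ι → ℂ} {q : ℕ}

theorem hasDerivAt_riccatiSum {z w : ℝ → ι → ℂ} {B : ℝ} {s : Set ℝ} (hs : IsOpen s)
    (hs' : IsPreconnected s)
    (hne : ∀ j < q, ∀ k : Fin (j + 1) → ι, (∀ i, c (k i) ≠ 0) → η - ∑ i, φ (k i) ≠ 0)
    (hc : Summable fun k => ‖c k‖)
    (hterm : ∀ j ≤ q, Summable fun k => ‖smallDivisorTerm η φ c j k‖)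
    (hz : ∀ x ∈ s, ∀ k, HasDerivAt (fun x => z x k) (-Complex.I * φ k * z x k + w x k) x)
    (hzB : ∀ x ∈ s, ∀ k, ‖z x k‖ ≤ ‖c k‖ * B) (hwB : ∀ x ∈ s, ∀ k, ‖w x k‖ ≤ ‖c k‖ * B)
    {x : ℝ} (hx : x ∈ s) (v : ℝ) :
    HasDerivAt (fun x => riccatiSum η φ (z x) q)
      (riccatiField η v (riccatiSum η φ (z x) q) + riccatiDefect η φ (z x) (w x) q v) x := by
  refine (HasDerivAt.fun_sum fun J hJ => hasDerivAt_smallDivisorSum hs hs'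
    (hne J (Finset.mem_range.1 hJ)) hc (fun j hj => hterm j (hj.trans (Finset.mem_range.1 hJ)))
    hz hzB hwB hx).congr_deriv ?_
  have sq_one_add := sq_sum_range_succ (smallDivisorSum η φ (z x)) q
  rw [Finset.sum_range_succ', smallDivisorSum_zero, ← riccatiSum] at sq_one_add
  rw [Finset.sum_add_distrib, Finset.sum_add_distrib, ← Finset.mul_sum, ← Finset.mul_sum,
    ← Finset.mul_sum, ← riccatiSum, riccatiField, riccatiDefect]
  linear_combination (-(Complex.I * (∑' k, z x k))) * sq_one_add

variable {α : Type*} {l : Filter α} {z w : α → ι → ℂ} {v τ : α → ℝ}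

theorem isBigO_riccatiSum (hτ : τ =O[l] (1 : α → ℝ))
    (hH : ∀ j ≤ q, (fun a => smallDivisorSum η φ (z a) j) =O[l] fun a => τ a ^ j) :
    (fun a => riccatiSum η φ (z a) q) =O[l] τ := by
  refine .fun_sum fun j hj => (hH (j + 1) (Finset.mem_range.1 hj)).trans ?_
  simpa [pow_succ] using (hτ.pow j).mul (Asymptotics.isBigO_refl τ l)

theorem isBigO_riccatiDefect (hτ : τ =O[l] (1 : α → ℝ))
    (hH : ∀ j ≤ q, (fun a => smallDivisorSum η φ (z a) j) =O[l] fun a => τ a ^ j)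
    (hD : ∀ j ≤ q, (fun a => smallDivisorSumDeriv η φ (z a) (w a) j) =O[l] fun a => τ a ^ (q + 1))
    (hT : (fun a => ∑' k, z a k) =O[l] τ)
    (hTv : (fun a => ∑' k, z a k - v a) =O[l] fun a => τ a ^ (q + 1)) :
    (fun a => riccatiDefect η φ (z a) (w a) q (v a)) =O[l] fun a => τ a ^ (q + 1) := by
  have absorb (m : ℕ) : (fun a => τ a ^ (q + 1 + m)) =O[l] fun a => τ a ^ (q + 1) := by
    simpa [pow_add] using (Asymptotics.isBigO_refl (fun a => τ a ^ (q + 1)) l).mul (hτ.pow m)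
  have one_add_sq_isBigO : (fun a => (1 + riccatiSum η φ (z a) q) ^ 2) =O[l] (1 : α → ℝ) := by
    exact (((Asymptotics.isBigO_const_const (1 : ℂ) (one_ne_zero (α := ℝ)) l).add
      ((isBigO_riccatiSum hτ hH).trans hτ)).pow 2).congr_right fun _ => one_pow 2
  refine ((Asymptotics.IsBigO.fun_sum fun j hj => hD (j + 1) (Finset.mem_range.1 hj)).sub ?_).add ?_
  · have tail_isBigO : (fun a => (∑' k, z a k) * ∑ ij ∈ (Finset.range (q + 1) ×ˢ
        Finset.range (q + 1)).filter (fun ij => q ≤ ij.1 + ij.2),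
          smallDivisorSum η φ (z a) ij.1 * smallDivisorSum η φ (z a) ij.2) =O[l]
        fun a => τ a ^ (q + 1) := by
      simp only [Finset.mul_sum]
      refine .fun_sum fun ij hij => ?_
      simp only [Finset.mem_filter, Finset.mem_product, Finset.mem_range] at hij
      refine (hT.mul ((hH ij.1 (by omega)).mul (hH ij.2 (by omega)))).trans ?_
      refine (absorb (ij.1 + ij.2 - q)).congr_left fun a => ?_
      rw [← pow_add, ← pow_succ']
      congr 1
      omega
    simpa only [mul_assoc] using tail_isBigO.const_mul_left Complex.I
  · simpa [mul_assoc] using (hTv.mul one_add_sq_isBigO).const_mul_left Complex.I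

end RiccatiSum

theorem summable_tsum_mul_of_sum_range_le {ι : Type*} {W : ι → ℝ} {δ : ι → ℕ → ℝ} {K : ℝ}
    (hW : Summable W) (hW0 : ∀ i, 0 ≤ W i) (hδ0 : ∀ i n, 0 ≤ δ i n)
    (hδ : ∀ i N, ∑ n ∈ Finset.range N, δ i n ≤ K) : Summable fun n => ∑' i, W i * δ i n := by
  have hsummable (n : ℕ) : Summable fun i => W i * δ i n := by
    refine .of_nonneg_of_le (fun i => mul_nonneg (hW0 i) (hδ0 i n)) (fun i => ?_) (hW.mul_right K)
    refine mul_le_mul_of_nonneg_left ?_ (hW0 i)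
    exact (Finset.single_le_sum (f := δ i) (fun n _ => hδ0 i n)
      (Finset.self_mem_range_succ n)).trans (hδ i (n + 1))
  refine summable_of_sum_range_le (c := (∑' i, W i) * K)
    (fun n => tsum_nonneg fun i => mul_nonneg (hW0 i) (hδ0 i n)) fun N => ?_
  rw [← Summable.tsum_finsetSum fun n _ => hsummable n, ← tsum_mul_right]
  refine Summable.tsum_le_tsum (fun i => ?_) (summable_sum fun n _ => hsummable n)
    (hW.mul_right K)
  rw [← Finset.mul_sum]
  exact mul_le_mul_of_nonneg_left (hδ i N) (hW0 i)

theorem prod_add_le_pow_add_sum {ι : Type*} (s : Finset ι) {a M : ℝ} {d : ι → ℝ} (ha : 0 ≤ a)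
    (haM : a ≤ M) (hM : 1 ≤ M) (hd : ∀ i, 0 ≤ d i) (hdM : ∀ i, d i ≤ M) :
    ∏ i ∈ s, (a + d i) ≤ a ^ s.card + (2 * M) ^ s.card * ∑ i ∈ s, d i := by
  classical
  induction s using Finset.induction_on with
  | empty => simp
  | insert i s hi ih =>
    rw [Finset.prod_insert hi, Finset.sum_insert hi, Finset.card_insert_of_notMem hi]
    have hs : 0 ≤ ∑ i ∈ s, d i := Finset.sum_nonneg fun i _ => hd i
    have pow_card_le : a ^ s.card ≤ (2 * M) ^ (s.card + 1) :=
      calc a ^ s.card ≤ (2 * M) ^ s.card := pow_le_pow_left₀ ha (by linarith) _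
        _ ≤ (2 * M) ^ (s.card + 1) := pow_le_pow_right₀ (by linarith) (by omega)
    have add_le : a + d i ≤ 2 * M := by linarith [hdM i]
    have hdi := hd i
    calc (a + d i) * ∏ i ∈ s, (a + d i)
        ≤ (a + d i) * (a ^ s.card + (2 * M) ^ s.card * ∑ i ∈ s, d i) := by gcongr
      _ = a ^ (s.card + 1) + a ^ s.card * d i +
          (a + d i) * ((2 * M) ^ s.card * ∑ i ∈ s, d i) := by ring
      _ ≤ a ^ (s.card + 1) + (2 * M) ^ (s.card + 1) * d i +
          (2 * M) * ((2 * M) ^ s.card * ∑ i ∈ s, d i) := by gcongr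
      _ = _ := by ring

theorem tendsto_zero_of_summable_pow {τ : ℕ → ℝ} {m : ℕ} (hm : m ≠ 0)
    (h : Summable fun n => τ n ^ m) : Filter.Tendsto τ Filter.atTop (nhds 0) := by
  rw [tendsto_zero_iff_norm_tendsto_zero]
  have hroot := h.tendsto_atTop_zero.norm.rpow_const (p := (m : ℝ)⁻¹) (.inr (by positivity))
  simpa [Real.pow_rpow_inv_natCast, hm, Real.zero_rpow] using hroot

section Majorant

variable {ι : Type*}

/-- The weight with which the variations `δ_k` of the amplitudes enter the estimates for
`smallDivisorSum` and its derivative. -/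
noncomputable def smallDivisorVariation (η : ℝ) (φ : ι → ℝ) (c : ι → ℂ) (δ : ι → ℝ) (J : ℕ) : ℝ :=
  ∑' k : Fin J → ι, ‖smallDivisorTerm η φ c J k‖ * ∑ i, δ (k i)

variable {η : ℝ} {φ : ι → ℝ} {c : ι → ℂ} {J : ℕ}

theorem smallDivisorVariation_nonneg {δ : ι → ℝ} (hδ0 : ∀ k, 0 ≤ δ k) (J : ℕ) :
    0 ≤ smallDivisorVariation η φ c δ J :=
  tsum_nonneg fun _ => mul_nonneg (norm_nonneg _) (Finset.sum_nonneg fun _ _ => hδ0 _)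

theorem summable_norm_smallDivisorTerm_mul_sum {δ : ι → ℝ} {M : ℝ} (hδ0 : ∀ k, 0 ≤ δ k)
    (hδM : ∀ k, δ k ≤ M) (hterm : Summable fun k => ‖smallDivisorTerm η φ c J k‖) :
    Summable fun k => ‖smallDivisorTerm η φ c J k‖ * ∑ i, δ (k i) :=
  .of_nonneg_of_le (fun _ => mul_nonneg (norm_nonneg _) (Finset.sum_nonneg fun _ _ => hδ0 _))
    (fun _ => mul_le_mul_of_nonneg_left (Finset.sum_le_sum fun _ _ => hδM _) (norm_nonneg _))
    (hterm.mul_right (∑ _i : Fin J, M))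

theorem norm_smallDivisorSum_le {z : ι → ℂ} {δ : ι → ℝ} {S M : ℝ} (hS : 0 ≤ S) (hSM : S ≤ M)
    (hM : 1 ≤ M) (hδ0 : ∀ k, 0 ≤ δ k) (hδM : ∀ k, δ k ≤ M)
    (hterm : Summable fun k => ‖smallDivisorTerm η φ c J k‖)
    (hz : ∀ k, ‖z k‖ ≤ ‖c k‖ * (S + δ k)) :
    ‖smallDivisorSum η φ z J‖ ≤ (∑' k, ‖smallDivisorTerm η φ c J k‖) * S ^ J +
      (2 * M) ^ J * smallDivisorVariation η φ c δ J := by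
  refine tsum_of_norm_bounded ((hterm.hasSum.mul_right _).add
    ((summable_norm_smallDivisorTerm_mul_sum hδ0 hδM hterm).hasSum.mul_left _)) fun k => ?_
  have prod_le := prod_add_le_pow_add_sum (Finset.univ : Finset (Fin J)) hS hSM hM
    (fun i => hδ0 (k i)) (fun i => hδM (k i))
  rw [Finset.card_univ, Fintype.card_fin] at prod_le
  refine (norm_smallDivisorTerm_le_mul_prod hz J k).trans ?_
  refine (mul_le_mul_of_nonneg_left prod_le (norm_nonneg _)).trans_eq ?_
  ring

theorem norm_smallDivisorSumDeriv_le {z w : ι → ℂ} {δ : ι → ℝ} {B M : ℝ} (hδ0 : ∀ k, 0 ≤ δ k)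
    (hδM : ∀ k, δ k ≤ M) (hterm : Summable fun k => ‖smallDivisorTerm η φ c J k‖)
    (hz : ∀ k, ‖z k‖ ≤ ‖c k‖ * B) (hw : ∀ k, ‖w k‖ ≤ ‖c k‖ * δ k) :
    ‖smallDivisorSumDeriv η φ z w J‖ ≤ B ^ (J - 1) * smallDivisorVariation η φ c δ J := by
  refine tsum_of_norm_bounded
    ((summable_norm_smallDivisorTerm_mul_sum hδ0 hδM hterm).hasSum.mul_left _) fun k => ?_
  refine (norm_smallDivisorTermDeriv_le hz hw J k).trans_eq ?_
  ring

/-- Bounds for a family of amplitudes on the `n`-th unit interval: `S n` for the common size and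
`δ k n` for the variation of the `k`-th amplitude. -/
structure AmplitudeBounds (m : ℕ) (M : ℝ) (S : ℕ → ℝ) (δ : ι → ℕ → ℝ) : Prop where
  one_le : 1 ≤ M
  nonneg : ∀ n, 0 ≤ S n
  le : ∀ n, S n ≤ M
  summable_pow : Summable fun n => S n ^ m
  variation_nonneg : ∀ k n, 0 ≤ δ k n
  sum_variation_le : ∀ k N, ∑ n ∈ Finset.range N, δ k n ≤ M

variable {q : ℕ} {M : ℝ} {S : ℕ → ℝ} {δ : ι → ℕ → ℝ}

theorem AmplitudeBounds.variation_le {m : ℕ} (h : AmplitudeBounds m M S δ) (k : ι) (n : ℕ) :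
    δ k n ≤ M :=
  (Finset.single_le_sum (f := δ k) (fun n _ => h.variation_nonneg k n)
    (Finset.self_mem_range_succ n)).trans (h.sum_variation_le k (n + 1))

theorem AmplitudeBounds.summable_tsum_mul_variation {m : ℕ} (h : AmplitudeBounds m M S δ)
    (hc : Summable fun k => ‖c k‖) : Summable fun n => ∑' k, ‖c k‖ * δ k n :=
  summable_tsum_mul_of_sum_range_le hc (fun _ => norm_nonneg _) h.variation_nonneg
    h.sum_variation_le

theorem AmplitudeBounds.summable_smallDivisorVariation {m : ℕ} (h : AmplitudeBounds m M S δ)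
    (hterm : Summable fun k => ‖smallDivisorTerm η φ c J k‖) :
    Summable fun n => smallDivisorVariation η φ c (fun k => δ k n) J := by
  refine summable_tsum_mul_of_sum_range_le (K := ∑ _i : Fin J, M) hterm (fun _ => norm_nonneg _)
    (fun k n => Finset.sum_nonneg fun i _ => h.variation_nonneg _ _) fun k N => ?_
  rw [Finset.sum_comm]
  exact Finset.sum_le_sum fun i _ => h.sum_variation_le _ _

/-- A sequence that measures all the estimates at once: on the `n`-th unit interval `H_J` has size
`(τ n)^J`, and the errors, which are summable, have size `(τ n)^(q + 1)`. -/
structure IsMajorant (η : ℝ) (φ : ι → ℝ) (c : ι → ℂ) (q : ℕ) (S : ℕ → ℝ) (δ : ι → ℕ → ℝ)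
    (τ : ℕ → ℝ) : Prop where
  nonneg : ∀ n, 0 ≤ τ n
  summable_pow : Summable fun n => τ n ^ (q + 1)
  size_le : ∀ n, S n ≤ τ n
  tsum_mul_variation_le : ∀ n, ∑' k, ‖c k‖ * δ k n ≤ τ n ^ (q + 1)
  smallDivisorVariation_le : ∀ j ≤ q, ∀ n,
    smallDivisorVariation η φ c (fun k => δ k n) j ≤ τ n ^ (q + 1)

theorem AmplitudeBounds.exists_isMajorant (h : AmplitudeBounds (q + 1) M S δ)
    (hc : Summable fun k => ‖c k‖)
    (hterm : ∀ j ≤ q, Summable fun k => ‖smallDivisorTerm η φ c j k‖) :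
    ∃ τ, IsMajorant η φ c q S δ τ := by
  set e : ℕ → ℝ := fun n => ∑' k, ‖c k‖ * δ k n
  set D : ℕ → ℕ → ℝ := fun j n => smallDivisorVariation η φ c (fun k => δ k n) j
  set t : ℕ → ℝ := fun n => S n ^ (q + 1) + e n + ∑ j ∈ Finset.range (q + 1), D j n
  have hS0 (n : ℕ) : 0 ≤ S n ^ (q + 1) := pow_nonneg (h.nonneg n) _
  have he0 (n : ℕ) : 0 ≤ e n :=
    tsum_nonneg fun k => mul_nonneg (norm_nonneg _) (h.variation_nonneg k n)
  have hD0 (j n : ℕ) : 0 ≤ D j n := smallDivisorVariation_nonneg (fun k => h.variation_nonneg k n) j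
  have hsum0 (n : ℕ) : 0 ≤ ∑ j ∈ Finset.range (q + 1), D j n :=
    Finset.sum_nonneg fun j _ => hD0 j n
  have ht0 (n : ℕ) : 0 ≤ t n := add_nonneg (add_nonneg (hS0 n) (he0 n)) (hsum0 n)
  have hpow (n : ℕ) : (t n ^ ((q + 1 : ℕ) : ℝ)⁻¹) ^ (q + 1) = t n :=
    Real.rpow_inv_natCast_pow (ht0 n) (Nat.add_one_ne_zero q)
  refine ⟨fun n => t n ^ ((q + 1 : ℕ) : ℝ)⁻¹, fun n => Real.rpow_nonneg (ht0 n) _, ?_,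
    fun n => ?_, fun n => ?_, fun j hj n => ?_⟩
  · simp only [hpow]
    exact (h.summable_pow.add (h.summable_tsum_mul_variation hc)).add <| summable_sum fun j hj =>
      h.summable_smallDivisorVariation (hterm j (Finset.mem_range_succ_iff.1 hj))
  · refine le_of_pow_le_pow_left₀ (Nat.add_one_ne_zero q) (Real.rpow_nonneg (ht0 n) _) ?_
    rw [hpow]
    linarith [he0 n, hsum0 n]
  · rw [hpow]
    linarith [hS0 n, hsum0 n]
  · rw [hpow]
    linarith [hS0 n, he0 n, Finset.single_le_sum (f := fun j => D j n) (fun j _ => hD0 j n)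
      (Finset.mem_range_succ_iff.2 hj)]

namespace IsMajorant

variable {τ : ℕ → ℝ} {α : Type*} {z w : α → ι → ℂ}

theorem isBigO_one (h : IsMajorant η φ c q S δ τ) (n : α → ℕ) :
    (fun a => τ (n a)) =O[⊤] (1 : α → ℝ) := by
  obtain ⟨K, hK⟩ := (tendsto_zero_of_summable_pow q.succ_ne_zero h.summable_pow).bddAbove_range
  refine Asymptotics.isBigO_top.2 ⟨K, fun a => ?_⟩
  simpa [abs_of_nonneg (h.nonneg _)] using hK (mem_range_self (n a))

theorem pow_isBigO_pow (h : IsMajorant η φ c q S δ τ) (n : α → ℕ) {j : ℕ} (hj : j ≤ q + 1) :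
    (fun a => τ (n a) ^ (q + 1)) =O[⊤] fun a => τ (n a) ^ j := by
  simpa [← pow_add, Nat.add_sub_cancel' hj] using
    (Asymptotics.isBigO_refl (fun a => τ (n a) ^ j) ⊤).mul ((h.isBigO_one n).pow (q + 1 - j))

theorem size_isBigO (h : IsMajorant η φ c q S δ τ) (hb : AmplitudeBounds (q + 1) M S δ)
    (n : α → ℕ) : (fun a => S (n a)) =O[⊤] fun a => τ (n a) :=
  .of_norm_le fun _ => (Real.norm_of_nonneg (hb.nonneg _)).trans_le (h.size_le _)

theorem tsum_mul_variation_isBigO (h : IsMajorant η φ c q S δ τ)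
    (hb : AmplitudeBounds (q + 1) M S δ) (n : α → ℕ) :
    (fun a => ∑' k, ‖c k‖ * δ k (n a)) =O[⊤] fun a => τ (n a) ^ (q + 1) :=
  .of_norm_le fun _ => (Real.norm_of_nonneg <| tsum_nonneg fun k =>
    mul_nonneg (norm_nonneg _) (hb.variation_nonneg k _)).trans_le (h.tsum_mul_variation_le _)

theorem smallDivisorVariation_isBigO (h : IsMajorant η φ c q S δ τ)
    (hb : AmplitudeBounds (q + 1) M S δ) (n : α → ℕ) {j : ℕ} (hj : j ≤ q) :
    (fun a => smallDivisorVariation η φ c (fun k => δ k (n a)) j) =O[⊤]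
      fun a => τ (n a) ^ (q + 1) :=
  .of_norm_le fun _ => (Real.norm_of_nonneg <| smallDivisorVariation_nonneg
    (fun k => hb.variation_nonneg k _) j).trans_le (h.smallDivisorVariation_le j hj _)

theorem smallDivisorSum_isBigO (h : IsMajorant η φ c q S δ τ)
    (hb : AmplitudeBounds (q + 1) M S δ) {n : α → ℕ} {j : ℕ} (hj : j ≤ q)
    (hterm : Summable fun k => ‖smallDivisorTerm η φ c j k‖)
    (hz : ∀ a k, ‖z a k‖ ≤ ‖c k‖ * (S (n a) + δ k (n a))) :
    (fun a => smallDivisorSum η φ (z a) j) =O[⊤] fun a => τ (n a) ^ j :=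
  (Asymptotics.IsBigO.of_norm_le fun a => norm_smallDivisorSum_le (hb.nonneg _) (hb.le _)
    hb.one_le (fun k => hb.variation_nonneg k _) (fun k => hb.variation_le k _) hterm (hz a)).trans
    ((((h.size_isBigO hb n).pow j).const_mul_left _).add
      (((h.smallDivisorVariation_isBigO hb n hj).trans
        (h.pow_isBigO_pow n (by omega))).const_mul_left _))

theorem smallDivisorSumDeriv_isBigO (h : IsMajorant η φ c q S δ τ)
    (hb : AmplitudeBounds (q + 1) M S δ) {n : α → ℕ} {j : ℕ} (hj : j ≤ q)
    (hterm : Summable fun k => ‖smallDivisorTerm η φ c j k‖)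
    (hz : ∀ a k, ‖z a k‖ ≤ ‖c k‖ * (S (n a) + δ k (n a)))
    (hw : ∀ a k, ‖w a k‖ ≤ ‖c k‖ * δ k (n a)) :
    (fun a => smallDivisorSumDeriv η φ (z a) (w a) j) =O[⊤] fun a => τ (n a) ^ (q + 1) := by
  have hzM (a : α) (k : ι) : ‖z a k‖ ≤ ‖c k‖ * (M + M) := (hz a k).trans <|
    mul_le_mul_of_nonneg_left (add_le_add (hb.le _) (hb.variation_le k _)) (norm_nonneg _)
  exact (Asymptotics.IsBigO.of_norm_le fun a => norm_smallDivisorSumDeriv_le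
    (fun k => hb.variation_nonneg k _) (fun k => hb.variation_le k _) hterm (hzM a) (hw a)).trans
    ((h.smallDivisorVariation_isBigO hb n hj).const_mul_left _)

theorem tsum_isBigO (h : IsMajorant η φ c q S δ τ) (hb : AmplitudeBounds (q + 1) M S δ)
    {n : α → ℕ} (hc : Summable fun k => ‖c k‖)
    (hz : ∀ a k, ‖z a k‖ ≤ ‖c k‖ * (S (n a) + δ k (n a))) :
    (fun a => ∑' k, z a k) =O[⊤] fun a => τ (n a) := by
  have hsum (a : α) : Summable fun k => ‖c k‖ * δ k (n a) :=
    .of_nonneg_of_le (fun k => mul_nonneg (norm_nonneg _) (hb.variation_nonneg k _))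
      (fun k => mul_le_mul_of_nonneg_left (hb.variation_le k _) (norm_nonneg _)) (hc.mul_right M)
  have norm_tsum_le (a : α) : ‖∑' k, z a k‖ ≤ (∑' k, ‖c k‖) * S (n a) + ∑' k, ‖c k‖ * δ k (n a) :=
    tsum_of_norm_bounded ((hc.hasSum.mul_right _).add (hsum a).hasSum) fun k =>
      (hz a k).trans_eq (mul_add _ _ _)
  refine (Asymptotics.IsBigO.of_norm_le norm_tsum_le).trans
    (((h.size_isBigO hb n).const_mul_left _).add ((h.tsum_mul_variation_isBigO hb n).trans ?_))
  simpa using h.pow_isBigO_pow n (j := 1) (by omega)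

end IsMajorant

theorem AmplitudeBounds.exists_isBigO_riccati {α : Type*} {n : α → ℕ} {z w : α → ι → ℂ}
    {v : α → ℝ} (h : AmplitudeBounds (q + 1) M S δ) (hc : Summable fun k => ‖c k‖)
    (hterm : ∀ j ≤ q, Summable fun k => ‖smallDivisorTerm η φ c j k‖)
    (hz : ∀ a k, ‖z a k‖ ≤ ‖c k‖ * (S (n a) + δ k (n a)))
    (hw : ∀ a k, ‖w a k‖ ≤ ‖c k‖ * δ k (n a))
    (hv : ∀ a, ‖∑' k, z a k - v a‖ ≤ ∑' k, ‖c k‖ * δ k (n a)) :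
    ∃ τ : ℕ → ℝ, (Summable fun n => τ n ^ (q + 1)) ∧
      (fun a => riccatiSum η φ (z a) q) =O[⊤] (fun a => τ (n a)) ∧
      (fun a => riccatiDefect η φ (z a) (w a) q (v a)) =O[⊤] fun a => τ (n a) ^ (q + 1) := by
  obtain ⟨τ, hτ⟩ := h.exists_isMajorant hc hterm
  have hH (j : ℕ) (hj : j ≤ q) := hτ.smallDivisorSum_isBigO h hj (hterm j hj) hz
  exact ⟨τ, hτ.summable_pow, isBigO_riccatiSum (hτ.isBigO_one n) hH,
    isBigO_riccatiDefect (hτ.isBigO_one n) hH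
      (fun j hj => hτ.smallDivisorSumDeriv_isBigO h hj (hterm j hj) hz hw) (hτ.tsum_isBigO h hc hz)
      ((Asymptotics.IsBigO.of_norm_le hv).trans (hτ.tsum_mul_variation_isBigO h n))⟩

end Majorant

section BoundedVariation

variable {ι E : Type*} [SeminormedAddCommGroup E] {p : ℕ}

theorem norm_le_of_variation_of_lintegral {γ : ι → ℝ → E}
    (hvar : ⨆ k, eVariationOn (γ k) (Ioi 0) < ∞)
    (hLp : ∫⁻ x in Ioi (0 : ℝ), (⨆ k, ‖γ k x‖ₑ) ^ p < ∞) (k : ι) {x : ℝ} (hx : 0 < x) :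
    ‖γ k x‖ ≤ (⨆ k, eVariationOn (γ k) (Ioi 0)).toReal + 1 := by
  by_contra! hlt
  refine hLp.ne (top_unique ?_)
  calc (∞ : ℝ≥0∞) = ∫⁻ _x in Ioi (0 : ℝ), 1 := by simp
    _ ≤ _ := by
      refine setLIntegral_mono' measurableSet_Ioi fun y hy => one_le_pow₀ ?_
      refine le_trans ?_ (le_iSup (fun k => ‖γ k y‖ₑ) k)
      have edist_le := (eVariationOn.edist_le (γ k) (mem_Ioi.2 hx) hy).trans
        (le_iSup (fun k => eVariationOn (γ k) (Ioi 0)) k)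
      rw [edist_dist, ENNReal.ofReal_le_iff_le_toReal hvar.ne, dist_eq_norm] at edist_le
      rw [← ofReal_norm, ← ENNReal.ofReal_one]
      exact ENNReal.ofReal_le_ofReal (by linarith [norm_sub_norm_le (γ k x) (γ k y)])

/-- The total variation of `f` on `[n + 1, n + 2]`. The unit intervals start at `1`, because the
amplitudes are not defined at `0`. The value is `0` when the variation is infinite. -/
noncomputable def unitVariation (f : ℝ → E) (n : ℕ) : ℝ :=
  (eVariationOn f (Icc (n + 1) (n + 2))).toReal

/-- The infimum over `[n + 1, n + 2)` of the common size `sup_k |γ_k|` of a family. -/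
noncomputable def unitInfimum (γ : ι → ℝ → E) (n : ℕ) : ℝ≥0∞ :=
  ⨅ y ∈ Ico (n + 1 : ℝ) (n + 2), ⨆ k, ‖γ k y‖ₑ

theorem Icc_add_one_subset_Ioi (n : ℕ) : Icc (n + 1 : ℝ) (n + 2) ⊆ Ioi 0 :=
  fun _ hx => n.cast_add_one_pos.trans_le hx.1

theorem norm_sub_le_unitVariation {f : ℝ → E} (hf : BoundedVariationOn f (Ioi 0)) {n : ℕ}
    {x y : ℝ} (hx : x ∈ Icc (n + 1 : ℝ) (n + 2)) (hy : y ∈ Icc (n + 1 : ℝ) (n + 2)) :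
    ‖f x - f y‖ ≤ unitVariation f n :=
  dist_eq_norm (f x) (f y) ▸ (hf.mono (Icc_add_one_subset_Ioi n)).dist_le hx hy

theorem sum_unitVariation_le {f : ℝ → E} (hf : BoundedVariationOn f (Ioi 0)) (N : ℕ) :
    ∑ n ∈ Finset.range N, unitVariation f n ≤ (eVariationOn f (Ioi 0)).toReal := by
  have sum_eq := eVariationOn.sum' f (I := fun n : ℕ => (n + 1 : ℝ)) (n := N)
    fun a b h => by simpa using h
  simp only [Nat.cast_add, Nat.cast_one, add_assoc, one_add_one_eq_two] at sum_eq
  simp only [unitVariation]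
  rw [← ENNReal.toReal_sum fun n _ => hf.mono (Icc_add_one_subset_Ioi n), sum_eq]
  refine ENNReal.toReal_mono hf (eVariationOn.mono f fun x hx => ?_)
  exact lt_of_lt_of_le (by positivity) hx.1

theorem summable_unitInfimum_pow {γ : ι → ℝ → E}
    (hLp : ∫⁻ x in Ioi (0 : ℝ), (⨆ k, ‖γ k x‖ₑ) ^ p < ∞) :
    Summable fun n => (unitInfimum γ n).toReal ^ p := by
  have pow_le_lintegral (n : ℕ) :
      unitInfimum γ n ^ p ≤ ∫⁻ x in Ico (n + 1 : ℝ) (n + 2), (⨆ k, ‖γ k x‖ₑ) ^ p := by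
    calc unitInfimum γ n ^ p = ∫⁻ _x in Ico (n + 1 : ℝ) (n + 2), unitInfimum γ n ^ p := by
          rw [setLIntegral_const, Real.volume_Ico]
          norm_num
      _ ≤ _ := setLIntegral_mono' measurableSet_Ico fun y hy =>
          pow_le_pow_left₀ zero_le (iInf₂_le y hy) p
  have pairwise_disjoint : Pairwise (Function.onFun Disjoint
      fun n : ℕ => Ico (n + 1 : ℝ) (n + 2)) := by
    have mono : Monotone fun n : ℕ => (n + 1 : ℝ) := fun a b h => by simpa using h
    simpa only [Order.succ_eq_add_one, Nat.cast_add, Nat.cast_one, add_assoc,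
      one_add_one_eq_two] using mono.pairwise_disjoint_on_Ico_succ
  have tsum_ne_top : ∑' n, unitInfimum γ n ^ p ≠ ∞ := by
    refine ne_top_of_le_ne_top hLp.ne ((ENNReal.tsum_le_tsum pow_le_lintegral).trans ?_)
    rw [← lintegral_iUnion (fun n => measurableSet_Ico) pairwise_disjoint]
    exact lintegral_mono_set (iUnion_subset fun n =>
      Ico_subset_Icc_self.trans (Icc_add_one_subset_Ioi n))
  simpa using ENNReal.summable_toReal tsum_ne_top

theorem unitInfimum_le {γ : ι → ℝ → E} {M : ℝ} (hM : ∀ k x, 0 < x → ‖γ k x‖ ≤ M) (n : ℕ) :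
    unitInfimum γ n ≤ ENNReal.ofReal M := by
  refine (iInf₂_le (n + 1 : ℝ) ⟨le_rfl, by linarith⟩).trans (iSup_le fun k => ?_)
  rw [← ofReal_norm]
  exact ENNReal.ofReal_le_ofReal (hM k _ n.cast_add_one_pos)

theorem norm_le_unitInfimum_add_unitVariation {γ : ι → ℝ → E} {k : ι} {n : ℕ}
    (hk : BoundedVariationOn (γ k) (Ioi 0)) (hfin : unitInfimum γ n ≠ ∞) {x : ℝ}
    (hx : x ∈ Icc (n + 1 : ℝ) (n + 2)) :
    ‖γ k x‖ ≤ (unitInfimum γ n).toReal + unitVariation (γ k) n := by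
  have hvar := hk.mono (Icc_add_one_subset_Ioi n)
  have enorm_le : ‖γ k x‖ₑ ≤ unitInfimum γ n + eVariationOn (γ k) (Icc (n + 1) (n + 2)) := by
    rw [← tsub_le_iff_right]
    refine le_iInf₂ fun y hy => ?_
    rw [tsub_le_iff_right]
    calc ‖γ k x‖ₑ ≤ ‖γ k y‖ₑ + edist (γ k x) (γ k y) := by
          rw [← edist_zero_right, ← edist_zero_right, add_comm]
          exact edist_triangle _ _ _
      _ ≤ _ := add_le_add (le_iSup (fun k => ‖γ k y‖ₑ) k)
          (eVariationOn.edist_le (γ k) hx (Ico_subset_Icc_self hy))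
  rw [← toReal_enorm, unitVariation, ← ENNReal.toReal_add hfin hvar]
  exact ENNReal.toReal_mono (ENNReal.add_ne_top.2 ⟨hfin, hvar⟩) enorm_le

theorem amplitudeBounds_of_variation_of_lintegral {γ : ι → ℝ → E}
    (hvar : ⨆ k, eVariationOn (γ k) (Ioi 0) < ∞)
    (hLp : ∫⁻ x in Ioi (0 : ℝ), (⨆ k, ‖γ k x‖ₑ) ^ p < ∞) :
    AmplitudeBounds p ((⨆ k, eVariationOn (γ k) (Ioi 0)).toReal + 1)
      (fun n => (unitInfimum γ n).toReal) (fun k n => unitVariation (γ k) n) where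
  one_le := le_add_of_nonneg_left ENNReal.toReal_nonneg
  nonneg _ := ENNReal.toReal_nonneg
  le n := ENNReal.toReal_le_of_le_ofReal (by positivity)
    (unitInfimum_le (fun k _ => norm_le_of_variation_of_lintegral hvar hLp k) n)
  summable_pow := summable_unitInfimum_pow hLp
  variation_nonneg _ _ := ENNReal.toReal_nonneg
  sum_variation_le k N := by
    have le_sup := le_iSup (fun k => eVariationOn (γ k) (Ioi 0)) k
    refine (sum_unitVariation_le (le_sup.trans_lt hvar).ne N).trans ?_
    linarith [ENNReal.toReal_mono hvar.ne le_sup]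

end BoundedVariation

section UnitInterp

variable {E : Type*} [NormedAddCommGroup E] [NormedSpace ℝ E]

/-- The affine function that agrees with `f` at the ends of `[n + 1, n + 2]`. -/
noncomputable def unitInterp (f : ℝ → E) (n : ℕ) (x : ℝ) : E :=
  AffineMap.lineMap (f (n + 1)) (f (n + 2)) (x - (n + 1))

theorem hasDerivAt_unitInterp (f : ℝ → E) (n : ℕ) (x : ℝ) :
    HasDerivAt (unitInterp f n) (f (n + 2) - f (n + 1)) x :=
  AffineMap.hasDerivAt_lineMap.comp_sub_const x (n + 1 : ℝ)

theorem unitInterp_add_one_self (f : ℝ → E) (n : ℕ) :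
    unitInterp f (n + 1) (n + 2) = unitInterp f n (n + 2) := by
  simp only [unitInterp, Nat.cast_add, Nat.cast_one, add_assoc, one_add_one_eq_two, sub_self,
    AffineMap.lineMap_apply_zero, add_sub_add_left_eq_sub]
  norm_num

theorem unitInterp_mem_of_convex {f : ℝ → E} {n : ℕ} {s : Set E} (hs : Convex ℝ s)
    (hf : ∀ x ∈ Icc (n + 1 : ℝ) (n + 2), f x ∈ s) {x : ℝ} (hx : x ∈ Icc (n + 1 : ℝ) (n + 2)) :
    unitInterp f n x ∈ s :=
  hs.lineMap_mem (hf _ ⟨le_rfl, by linarith⟩) (hf _ ⟨by linarith, le_rfl⟩)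
    ⟨by linarith [hx.1], by linarith [hx.2]⟩

theorem norm_unitInterp_le_of_mem_Ioo {f : ℝ → E} {M : ℝ} (hf : ∀ x, 0 < x → ‖f x‖ ≤ M) {n : ℕ}
    {x : ℝ} (hx : x ∈ Ioo (n : ℝ) (n + 3)) : ‖unitInterp f n x‖ ≤ 5 * M := by
  have left_le := hf (n + 1) (by positivity)
  have right_le := hf (n + 2) (by positivity)
  have abs_le : |x - (n + 1)| ≤ 2 := abs_le.2 ⟨by linarith [hx.1], by linarith [hx.2]⟩
  rw [unitInterp, AffineMap.lineMap_apply_module', add_comm]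
  calc _ ≤ ‖f (n + 1)‖ + |x - (n + 1)| * (‖f (n + 2)‖ + ‖f (n + 1)‖) := by
        refine (norm_add_le _ _).trans ?_
        rw [norm_smul, Real.norm_eq_abs]
        gcongr
        exact norm_sub_le _ _
    _ ≤ M + 2 * (M + M) := by gcongr
    _ = 5 * M := by ring

end UnitInterp

section ApproxRiccatiSolution

variable {ι : Type*} {c : ι → ℂ} {φ : ι → ℝ}

/-- The oscillating term `c_k e^{-iφ_k x} b_k`. -/
noncomputable def oscTerm (c : ι → ℂ) (φ : ι → ℝ) (b : ι → ℂ) (x : ℝ) (k : ι) : ℂ :=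
  c k * Complex.exp (-Complex.I * φ k * x) * b k

theorem norm_oscTerm (b : ι → ℂ) (x : ℝ) (k : ι) : ‖oscTerm c φ b x k‖ = ‖c k‖ * ‖b k‖ := by
  have exponent_eq : -Complex.I * φ k * x = ((-(φ k * x) : ℝ) : ℂ) * Complex.I := by
    push_cast
    ring
  rw [oscTerm, norm_mul, norm_mul, exponent_eq, Complex.norm_exp_ofReal_mul_I, mul_one]

theorem hasSum_oscTerm_const_mul {b : ι → ℂ} {x : ℝ} {s : ℂ} (h : HasSum (oscTerm c φ b x) s)
    (a : ℂ) : HasSum (oscTerm (fun k => a * c k) φ b x) (a * s) := by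
  have oscTerm_eq : oscTerm (fun k => a * c k) φ b x = fun k => a * oscTerm c φ b x k :=
    funext fun k => by simp only [oscTerm, mul_assoc]
  exact oscTerm_eq ▸ h.mul_left a

theorem abs_le_of_hasSum_oscTerm {b : ι → ℂ} {x V M : ℝ} (hV : HasSum (oscTerm c φ b x) (V : ℂ))
    (hc : Summable fun k => ‖c k‖) (hb : ∀ k, ‖b k‖ ≤ M) : |V| ≤ (∑' k, ‖c k‖) * M := by
  rw [← Real.norm_eq_abs, ← Complex.norm_real, ← hV.tsum_eq]
  refine tsum_of_norm_bounded (hc.hasSum.mul_right M) fun k => ?_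
  rw [norm_oscTerm]
  gcongr
  exact hb k

theorem hasDerivAt_oscTerm {β : ℝ → ι → ℂ} {β' : ι → ℂ} {x : ℝ} {k : ι}
    (h : HasDerivAt (fun x => β x k) (β' k) x) :
    HasDerivAt (fun x => oscTerm c φ (β x) x k)
      (-Complex.I * φ k * oscTerm c φ (β x) x k + oscTerm c φ β' x k) x := by
  have hasDerivAt_cexp := (Complex.ofRealCLM.hasDerivAt.const_mul (-Complex.I * φ k)).cexp (x := x)
  refine ((hasDerivAt_cexp.const_mul (c k)).mul h).congr_deriv ?_
  simp only [oscTerm, Complex.ofRealCLM_apply, Complex.ofReal_one]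
  ring

/-- On `s`, the function `r` solves the Riccati equation `r' = -iηr + iv(1 + r)²` up to an error of
size at most `g`, and `‖r‖ ≤ 1/2`, so that `r` is uniformly away from the unit circle. -/
structure IsApproxRiccatiSolution (η : ℝ) (v : ℝ → ℝ) (s : Set ℝ) (g : ℝ) (r : ℝ → ℂ) : Prop where
  differentiableAt : ∀ x ∈ s, DifferentiableAt ℝ r x
  norm_le : ∀ x ∈ s, ‖r x‖ ≤ 1 / 2
  norm_sub_le : ∀ x ∈ s, ‖deriv r x - riccatiField η (v x) (r x)‖ ≤ g

/-- The terms `c_k e^{-iφ_k x} β_k(x)` of the potential, with each `γ_k` replaced on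
`[n + 1, n + 2]` by its affine interpolation `β_k`. -/
noncomputable def interpTerm (c : ι → ℂ) (φ : ι → ℝ) (γ : ι → ℝ → ℂ) (n : ℕ) (x : ℝ) : ι → ℂ :=
  oscTerm c φ (fun k => unitInterp (γ k) n x) x

/-- The part of the derivative of `interpTerm` that comes from the slopes of the interpolations. -/
noncomputable def interpTermDeriv (c : ι → ℂ) (φ : ι → ℝ) (γ : ι → ℝ → ℂ) (n : ℕ) (x : ℝ) : ι → ℂ :=
  oscTerm c φ (fun k => γ k (n + 2) - γ k (n + 1)) x

variable {γ : ι → ℝ → ℂ} {η : ℝ} {q : ℕ} {M : ℝ} {S : ℕ → ℝ} {δ : ι → ℕ → ℝ} {v : ℝ → ℝ}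

theorem hasDerivAt_riccatiSum_interpTerm
    (hne : ∀ j < q, ∀ k : Fin (j + 1) → ι, (∀ i, c (k i) ≠ 0) → η - ∑ i, φ (k i) ≠ 0)
    (hc : Summable fun k => ‖c k‖)
    (hterm : ∀ j ≤ q, Summable fun k => ‖smallDivisorTerm η φ c j k‖)
    (hγM : ∀ k x, 0 < x → ‖γ k x‖ ≤ M) {n : ℕ} {x : ℝ} (hx : x ∈ Icc (n + 1 : ℝ) (n + 2)) (v : ℝ) :
    HasDerivAt (fun x => riccatiSum η φ (interpTerm c φ γ n x) q)
      (riccatiField η v (riccatiSum η φ (interpTerm c φ γ n x) q) +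
        riccatiDefect η φ (interpTerm c φ γ n x) (interpTermDeriv c φ γ n x) q v) x := by
  refine hasDerivAt_riccatiSum (B := 5 * M) (s := Ioo (n : ℝ) (n + 3)) isOpen_Ioo
    isPreconnected_Ioo hne hc hterm
    (fun x _ k => hasDerivAt_oscTerm (hasDerivAt_unitInterp (γ k) n x))
    (fun x hx k => ?_) (fun x _ k => ?_) ⟨by linarith [hx.1], by linarith [hx.2]⟩ v
  · refine (norm_oscTerm _ _ _).trans_le ?_
    exact mul_le_mul_of_nonneg_left (norm_unitInterp_le_of_mem_Ioo (hγM k) hx) (norm_nonneg _)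
  · have left_le := hγM k (n + 1) (by positivity)
    have right_le := hγM k (n + 2) (by positivity)
    refine (norm_oscTerm _ _ _).trans_le ?_
    refine mul_le_mul_of_nonneg_left ((norm_sub_le _ _).trans ?_) (norm_nonneg _)
    linarith [norm_nonneg (γ k (n + 1))]

theorem norm_tsum_interpTerm_sub_le (hc : Summable fun k => ‖c k‖) {δ : ι → ℝ} {M : ℝ}
    (hδM : ∀ k, δ k ≤ M) {n : ℕ}
    (hγ : ∀ k, ∀ x ∈ Icc (n + 1 : ℝ) (n + 2), ∀ y ∈ Icc (n + 1 : ℝ) (n + 2),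
      ‖γ k x - γ k y‖ ≤ δ k)
    {x : ℝ} (hx : x ∈ Icc (n + 1 : ℝ) (n + 2)) {v : ℂ}
    (hv : HasSum (oscTerm c φ (fun k => γ k x) x) v) :
    ‖∑' k, interpTerm c φ γ n x k - v‖ ≤ ∑' k, ‖c k‖ * δ k := by
  have norm_sub_le (k : ι) :
      ‖interpTerm c φ γ n x k - oscTerm c φ (fun k => γ k x) x k‖ ≤ ‖c k‖ * δ k := by
    have sub_eq : interpTerm c φ γ n x k - oscTerm c φ (fun k => γ k x) x k =
        oscTerm c φ (fun k => unitInterp (γ k) n x - γ k x) x k := (mul_sub _ _ _).symm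
    rw [sub_eq, norm_oscTerm]
    refine mul_le_mul_of_nonneg_left (mem_closedBall_iff_norm.1 ?_) (norm_nonneg _)
    exact unitInterp_mem_of_convex (convex_closedBall _ _)
      (fun y hy => mem_closedBall_iff_norm.2 (hγ k y hy x hx)) hx
  have summable_bound : Summable fun k => ‖c k‖ * δ k :=
    .of_nonneg_of_le (fun k => (norm_nonneg _).trans (norm_sub_le k))
      (fun k => mul_le_mul_of_nonneg_left (hδM k) (norm_nonneg _)) (hc.mul_right M)
  have summable_sub := Summable.of_norm_bounded summable_bound norm_sub_le
  have tsum_sub : ∑' k, (interpTerm c φ γ n x k - oscTerm c φ (fun k => γ k x) x k) =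
      ∑' k, interpTerm c φ γ n x k - v := by
    rw [← hv.tsum_eq, ← Summable.tsum_sub ?_ hv.summable]
    simpa using summable_sub.add hv.summable
  exact tsum_sub ▸ tsum_of_norm_bounded summable_bound.hasSum norm_sub_le

theorem exists_isBigO_riccati_interpTerm (h : AmplitudeBounds (q + 1) M S δ)
    (hc : Summable fun k => ‖c k‖)
    (hterm : ∀ j ≤ q, Summable fun k => ‖smallDivisorTerm η φ c j k‖)
    (hγ : ∀ k (n : ℕ), ∀ x ∈ Icc (n + 1 : ℝ) (n + 2), ‖γ k x‖ ≤ S n + δ k n)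
    (hγ' : ∀ k (n : ℕ), ∀ x ∈ Icc (n + 1 : ℝ) (n + 2), ∀ y ∈ Icc (n + 1 : ℝ) (n + 2),
      ‖γ k x - γ k y‖ ≤ δ k n)
    (hv : ∀ x, 0 < x → HasSum (oscTerm c φ (fun k => γ k x) x) (v x : ℂ)) :
    ∃ (τ : ℕ → ℝ) (K : ℝ), (Summable fun n => τ n ^ (q + 1)) ∧
      ∀ (n : ℕ), ∀ x ∈ Icc (n + 1 : ℝ) (n + 2),
        ‖riccatiSum η φ (interpTerm c φ γ n x) q‖ ≤ K * ‖τ n‖ ∧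
        ‖riccatiDefect η φ (interpTerm c φ γ n x) (interpTermDeriv c φ γ n x) q (v x)‖ ≤
          K * ‖τ n ^ (q + 1)‖ := by
  have hz (a : {a : ℕ × ℝ // a.2 ∈ Icc (a.1 + 1 : ℝ) (a.1 + 2)}) (k : ι) :
      ‖interpTerm c φ γ a.1.1 a.1.2 k‖ ≤ ‖c k‖ * (S a.1.1 + δ k a.1.1) := by
    refine (norm_oscTerm _ _ _).trans_le ?_
    refine mul_le_mul_of_nonneg_left (mem_closedBall_zero_iff.1 ?_) (norm_nonneg _)
    exact unitInterp_mem_of_convex (convex_closedBall _ _)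
      (fun y hy => mem_closedBall_zero_iff.2 (hγ k _ y hy)) a.2
  have hw (a : {a : ℕ × ℝ // a.2 ∈ Icc (a.1 + 1 : ℝ) (a.1 + 2)}) (k : ι) :
      ‖interpTermDeriv c φ γ a.1.1 a.1.2 k‖ ≤ ‖c k‖ * δ k a.1.1 := by
    refine (norm_oscTerm _ _ _).trans_le ?_
    exact mul_le_mul_of_nonneg_left
      (hγ' k _ _ ⟨by linarith, le_rfl⟩ _ ⟨le_rfl, by linarith⟩) (norm_nonneg _)
  obtain ⟨τ, hτ, size, defect⟩ := h.exists_isBigO_riccati (η := η) (φ := φ) hc hterm hz hw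
    (v := fun a => v a.1.2) fun a =>
      norm_tsum_interpTerm_sub_le hc (fun k => h.variation_le k a.1.1) (fun k => hγ' k a.1.1) a.2
        (hv a.1.2 (Icc_add_one_subset_Ioi _ a.2))
  obtain ⟨K₁, hK₁⟩ := Asymptotics.isBigO_top.1 size
  obtain ⟨K₂, hK₂⟩ := Asymptotics.isBigO_top.1 defect
  refine ⟨τ, max K₁ K₂, hτ, fun n x hx => ⟨(hK₁ ⟨(n, x), hx⟩).trans ?_,
    (hK₂ ⟨(n, x), hx⟩).trans ?_⟩⟩
  · exact mul_le_mul_of_nonneg_right (le_max_left _ _) (norm_nonneg _)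
  · exact mul_le_mul_of_nonneg_right (le_max_right _ _) (norm_nonneg _)

theorem exists_isApproxRiccatiSolution
    (hne : ∀ j < q, ∀ k : Fin (j + 1) → ι, (∀ i, c (k i) ≠ 0) → η - ∑ i, φ (k i) ≠ 0)
    (hc : Summable fun k => ‖c k‖)
    (hterm : ∀ j ≤ q, Summable fun k => ‖smallDivisorTerm η φ c j k‖)
    (hv : ∀ x, 0 < x → HasSum (oscTerm c φ (fun k => γ k x) x) (v x : ℂ))
    (hvar : ⨆ k, eVariationOn (γ k) (Ioi 0) < ∞)
    (hLp : ∫⁻ x in Ioi (0 : ℝ), (⨆ k, ‖γ k x‖ₑ) ^ (q + 1) < ∞) :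
    ∃ (r : ℕ → ℝ → ℂ) (g : ℕ → ℝ), Summable g ∧
      (∀ n : ℕ, r (n + 1) (n + 2) = r n (n + 2)) ∧
      ∀ᶠ n : ℕ in Filter.atTop, IsApproxRiccatiSolution η v (Icc (n + 1) (n + 2)) (g n) (r n) := by
  have bounds := amplitudeBounds_of_variation_of_lintegral hvar hLp
  have hγM (k : ι) (x : ℝ) (hx : 0 < x) := norm_le_of_variation_of_lintegral hvar hLp k hx
  have hbv (k : ι) : BoundedVariationOn (γ k) (Ioi 0) :=
    ((le_iSup (fun k => eVariationOn (γ k) (Ioi 0)) k).trans_lt hvar).ne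
  obtain ⟨τ, K, hτ, hK⟩ := exists_isBigO_riccati_interpTerm bounds hc hterm
    (fun k n x hx => norm_le_unitInfimum_add_unitVariation (hbv k)
      ((unitInfimum_le hγM n).trans_lt ENNReal.ofReal_lt_top).ne hx)
    (fun k n x hx y hy => norm_sub_le_unitVariation (hbv k) hx hy) hv
  refine ⟨fun n x => riccatiSum η φ (interpTerm c φ γ n x) q, fun n => K * ‖τ n ^ (q + 1)‖,
    hτ.norm.mul_left K, fun n => ?_, ?_⟩
  · simp only [interpTerm, unitInterp_add_one_self]
  have tendsto : Filter.Tendsto (fun n => K * ‖τ n‖) Filter.atTop (nhds 0) := by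
    simpa using (tendsto_zero_of_summable_pow q.succ_ne_zero hτ).norm.const_mul K
  filter_upwards [tendsto.eventually_le_const one_half_pos] with n hn
  have hasDerivAt (x : ℝ) (hx : x ∈ Icc (n + 1 : ℝ) (n + 2)) :=
    hasDerivAt_riccatiSum_interpTerm hne hc hterm hγM hx (v x)
  refine ⟨fun x hx => (hasDerivAt x hx).differentiableAt, fun x hx => (hK n x hx).1.trans hn,
    fun x hx => ?_⟩
  rw [(hasDerivAt x hx).deriv, add_sub_cancel_left]
  exact (hK n x hx).2

end ApproxRiccatiSolution

section AbsolutelyContinuous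

theorem absolutelyContinuousOnInterval_comp_of_lipschitzOnWith {X Y : Type*}
    [PseudoMetricSpace X] [PseudoMetricSpace Y] {K : NNReal} {F : X → Y} {f : ℝ → X} {s : Set X}
    {a b : ℝ} (hF : LipschitzOnWith K F s) (hf : AbsolutelyContinuousOnInterval f a b)
    (hfs : MapsTo f (uIcc a b) s) : AbsolutelyContinuousOnInterval (fun x => F (f x)) a b := by
  refine squeeze_zero' (.of_forall fun _ => Finset.sum_nonneg fun _ _ => dist_nonneg) ?_
    (by simpa using Filter.Tendsto.const_mul (K : ℝ) hf)
  refine Filter.eventually_inf_principal.2 (.of_forall fun I hI => ?_)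
  rw [Finset.mul_sum]
  exact Finset.sum_le_sum fun i hi => hF.dist_le_mul _ (hfs (hI.1 i hi).1) _ (hfs (hI.1 i hi).2)

variable {f : ℝ → ℝ} {a b K : ℝ}

theorem le_of_ae_deriv_nonpos (hab : a ≤ b) (hf : AbsolutelyContinuousOnInterval f a b)
    (h : ∀ᵐ x ∂volume.restrict (uIcc a b), deriv f x ≤ 0) : f b ≤ f a := by
  rw [uIcc_of_le hab] at h
  have integral_nonpos := intervalIntegral.integral_mono_ae_restrict hab
    hf.intervalIntegrable_deriv (intervalIntegrable_const (c := (0 : ℝ))) h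
  rw [hf.integral_deriv_eq_sub, intervalIntegral.integral_zero] at integral_nonpos
  exact sub_nonpos.1 integral_nonpos

theorem le_mul_exp_of_ae_deriv_le (hab : a ≤ b) (hf : AbsolutelyContinuousOnInterval f a b)
    (h : ∀ᵐ x ∂volume.restrict (uIcc a b), deriv f x ≤ K * f x) :
    f b ≤ f a * Real.exp (K * (b - a)) := by
  have exp_ac : AbsolutelyContinuousOnInterval (fun x => Real.exp (-K * x)) a b :=
    ContDiffOn.absolutelyContinuousOnInterval (by fun_prop)
  have mul_exp_le := le_of_ae_deriv_nonpos hab (hf.fun_mul exp_ac) <| by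
    filter_upwards [h, ae_restrict_of_ae hf.ae_differentiableAt, ae_restrict_mem measurableSet_uIcc]
      with x hx differentiableAt hmem
    have hexp : HasDerivAt (fun x => Real.exp (-K * x)) (Real.exp (-K * x) * (-K * 1)) x :=
      ((hasDerivAt_id x).const_mul (-K)).exp
    rw [((differentiableAt hmem).hasDerivAt.fun_mul hexp).deriv]
    linarith [mul_nonneg (sub_nonneg.2 hx) (Real.exp_pos (-K * x)).le]
  calc f b = f b * Real.exp (-K * b) * Real.exp (K * b) := by
        rw [mul_assoc, ← Real.exp_add, neg_mul, neg_add_cancel, Real.exp_zero, mul_one]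
    _ ≤ f a * Real.exp (-K * a) * Real.exp (K * b) := by gcongr
    _ = f a * Real.exp (K * (b - a)) := by
        rw [mul_assoc, ← Real.exp_add]
        ring_nf

theorem le_mul_exp_of_ae_abs_deriv_le (hf : AbsolutelyContinuousOnInterval f a b)
    (h : ∀ᵐ x ∂volume.restrict (uIcc a b), |deriv f x| ≤ K * f x) :
    f b ≤ f a * Real.exp (K * |b - a|) := by
  rcases le_total a b with hab | hba
  · rw [abs_of_nonneg (sub_nonneg.2 hab)]
    exact le_mul_exp_of_ae_deriv_le hab hf (h.mono fun x hx => (le_abs_self _).trans hx)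
  · have neg_le := le_mul_exp_of_ae_deriv_le (K := -K) hba hf.symm.fun_neg <| by
      rw [uIcc_comm]
      filter_upwards [h] with x hx
      rw [deriv.fun_neg]
      linarith [neg_le_abs (deriv f x)]
    rw [abs_of_nonpos (sub_nonpos.2 hba)]
    calc f b = f b * Real.exp (-K * (a - b)) * Real.exp (K * -(b - a)) := by
          rw [mul_assoc, ← Real.exp_add]
          ring_nf
          rw [Real.exp_zero, mul_one]
      _ ≤ f a * Real.exp (K * -(b - a)) := by
          gcongr
          linarith

end AbsolutelyContinuous

section ReflectionEnergy

open ComplexConjugate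

/-- The right-hand side of the equation `a' = i(η/2)a - iv(a - b)`, which the amplitude
`a = u' + iηu/2` of a solution of `-u'' + ηvu = (η²/4)u` satisfies together with
`b = u' - iηu/2`. -/
noncomputable def amplitudeField (η v : ℝ) (a b : ℂ) : ℂ :=
  Complex.I * (η / 2) * a - Complex.I * v * (a - b)

/-- At `x`, the functions `a` and `b` satisfy the first order system of the amplitudes
`u' ± iηu/2`. -/
structure IsAmplitudePairAt (η v : ℝ) (a b : ℝ → ℂ) (x : ℝ) : Prop where
  left : HasDerivAt a (amplitudeField η v (a x) (b x)) x
  right : HasDerivAt b (-amplitudeField η v (b x) (a x)) x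

/-- The size `(‖b + ra‖² + ‖ā + rb̄‖²) / (1 - ‖r‖²)` of the pair `(a, b)` after the change of
variables that diagonalizes the system of the amplitudes when `r` solves the Riccati equation. -/
noncomputable def reflectionEnergy (a b r : ℂ) : ℝ :=
  (‖b + r * a‖ ^ 2 + ‖conj a + r * conj b‖ ^ 2) / (1 - ‖r‖ ^ 2)

variable {η v g : ℝ} {a b r : ℝ → ℂ} {x : ℝ} {ε : ℂ}

theorem IsAmplitudePairAt.conj (h : IsAmplitudePairAt η v a b x) :
    IsAmplitudePairAt η v (fun x => conj (b x)) (fun x => conj (a x)) x := by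
  refine ⟨h.right.star.congr_deriv ?_, h.left.star.congr_deriv ?_⟩ <;>
  · simp only [amplitudeField, Complex.star_def, map_neg, map_sub, map_mul, map_div₀,
      Complex.conj_I, Complex.conj_ofReal, map_ofNat]
    ring

theorem real_inner_mul_self (k w : ℂ) : inner ℝ w (k * w) = k.re * ‖w‖ ^ 2 := by
  rw [Complex.inner, mul_assoc, Complex.mul_conj', ← Complex.ofReal_pow, Complex.re_mul_ofReal]

theorem IsAmplitudePairAt.hasDerivAt_norm_sq_add_mul (h : IsAmplitudePairAt η v a b x)
    (hr : HasDerivAt r (riccatiField η v (r x) + ε) x) :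
    HasDerivAt (fun x => ‖b x + r x * a x‖ ^ 2)
      (2 * (-(v * (r x).im) * ‖b x + r x * a x‖ ^ 2 + inner ℝ (b x + r x * a x) (ε * a x))) x := by
  refine (h.right.add (hr.mul h.left)).norm_sq.congr_deriv ?_
  have deriv_eq : -amplitudeField η v (b x) (a x) + ((riccatiField η v (r x) + ε) * a x +
      r x * amplitudeField η v (a x) (b x)) =
      (-Complex.I * (η / 2) + Complex.I * v * (1 + r x)) * (b x + r x * a x) + ε * a x := by
    simp only [amplitudeField, riccatiField]
    ring
  have re_eq : (-Complex.I * (η / 2) + Complex.I * v * (1 + r x)).re = -(v * (r x).im) := by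
    simp
  rw [deriv_eq, Pi.add_apply, Pi.mul_apply, inner_add_right, real_inner_mul_self, re_eq]

theorem hasDerivAt_one_sub_norm_sq (hr : HasDerivAt r (riccatiField η v (r x) + ε) x) :
    HasDerivAt (fun x => 1 - ‖r x‖ ^ 2)
      (-(2 * (v * (r x).im * (1 - ‖r x‖ ^ 2) + inner ℝ (r x) ε))) x := by
  refine (hr.norm_sq.const_sub 1).congr_deriv ?_
  have inner_field : inner ℝ (r x) (riccatiField η v (r x)) =
      v * (r x).im * (1 - ‖r x‖ ^ 2) := by
    rw [Complex.inner, riccatiField, ← Complex.normSq_eq_norm_sq, Complex.normSq_apply]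
    simp [sq]
    ring
  rw [inner_add_right, inner_field]

theorem IsAmplitudePairAt.hasDerivAt_reflectionEnergy (h : IsAmplitudePairAt η v a b x)
    (hr : HasDerivAt r (riccatiField η v (r x) + ε) x) (hr1 : 1 - ‖r x‖ ^ 2 ≠ 0) :
    HasDerivAt (fun x => reflectionEnergy (a x) (b x) (r x))
      ((2 * (inner ℝ (b x + r x * a x) (ε * a x) +
          inner ℝ (conj (a x) + r x * conj (b x)) (ε * conj (b x))) +
        2 * inner ℝ (r x) ε * reflectionEnergy (a x) (b x) (r x)) / (1 - ‖r x‖ ^ 2)) x := by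
  refine (((h.hasDerivAt_norm_sq_add_mul hr).add (h.conj.hasDerivAt_norm_sq_add_mul hr)).div
    (hasDerivAt_one_sub_norm_sq hr) hr1).congr_deriv ?_
  simp only [reflectionEnergy, Pi.add_apply]
  field_simp
  ring

theorem three_div_four_le_one_sub_norm_sq {r : ℂ} (hr : ‖r‖ ≤ 1 / 2) : 3 / 4 ≤ 1 - ‖r‖ ^ 2 := by
  nlinarith [norm_nonneg r]

theorem sq_add_sq_le_of_norm_le_half {a b r : ℂ} (hr : ‖r‖ ≤ 1 / 2) :
    ‖a‖ ^ 2 + ‖b‖ ^ 2 ≤ 4 * (‖b + r * a‖ ^ 2 + ‖conj a + r * conj b‖ ^ 2) := by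
  have norm_le (a b : ℂ) : ‖b‖ ≤ ‖b + r * a‖ + ‖a‖ / 2 := by
    have := norm_sub_le (b + r * a) (r * a)
    rw [add_sub_cancel_right, norm_mul] at this
    nlinarith [norm_nonneg a]
  have norm_right_le := norm_le a b
  have norm_left_le := norm_le (conj b) (conj a)
  rw [RCLike.norm_conj, RCLike.norm_conj] at norm_left_le
  nlinarith [norm_nonneg a, norm_nonneg b, sq_nonneg (‖a‖ - ‖b‖),
    sq_nonneg (‖b + r * a‖ - ‖conj a + r * conj b‖)]

theorem sq_add_sq_le_reflectionEnergy {a b r : ℂ} (hr : ‖r‖ ≤ 1 / 2) :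
    ‖a‖ ^ 2 + ‖b‖ ^ 2 ≤ 4 * reflectionEnergy a b r := by
  have h34 := three_div_four_le_one_sub_norm_sq hr
  refine (sq_add_sq_le_of_norm_le_half hr).trans (mul_le_mul_of_nonneg_left ?_ zero_le_four)
  exact le_div_self (by positivity) (by linarith) (by linarith [sq_nonneg ‖r‖])

theorem abs_inner_add_inner_le {a b r ε : ℂ} {g : ℝ} (hr : ‖r‖ ≤ 1 / 2) (hε : ‖ε‖ ≤ g) :
    |inner ℝ (b + r * a) (ε * a) + inner ℝ (conj a + r * conj b) (ε * conj b)| ≤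
      2 * g * (‖b + r * a‖ ^ 2 + ‖conj a + r * conj b‖ ^ 2) := by
  have inner_le (w z : ℂ) : |inner ℝ w (ε * z)| ≤ g * (‖w‖ * ‖z‖) := by
    refine (abs_real_inner_le_norm _ _).trans ?_
    rw [norm_mul]
    exact (mul_le_mul_of_nonneg_left (mul_le_mul_of_nonneg_right hε (norm_nonneg z))
      (norm_nonneg w)).trans_eq (by ring)
  have mul_add_mul_le : ‖b + r * a‖ * ‖a‖ + ‖conj a + r * conj b‖ * ‖conj b‖ ≤
      2 * (‖b + r * a‖ ^ 2 + ‖conj a + r * conj b‖ ^ 2) := by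
    rw [RCLike.norm_conj]
    linarith [sq_add_sq_le_of_norm_le_half (a := a) (b := b) hr, sq_nonneg (‖b + r * a‖ - ‖a‖ / 2),
      sq_nonneg (‖conj a + r * conj b‖ - ‖b‖ / 2)]
  calc _ ≤ g * (‖b + r * a‖ * ‖a‖ + ‖conj a + r * conj b‖ * ‖conj b‖) := by
        rw [mul_add]
        exact (abs_add_le _ _).trans (add_le_add (inner_le _ _) (inner_le _ _))
    _ ≤ g * (2 * (‖b + r * a‖ ^ 2 + ‖conj a + r * conj b‖ ^ 2)) :=
        mul_le_mul_of_nonneg_left mul_add_mul_le ((norm_nonneg ε).trans hε)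
    _ = _ := by ring

theorem IsAmplitudePairAt.abs_deriv_reflectionEnergy_le (h : IsAmplitudePairAt η v a b x)
    (hr : DifferentiableAt ℝ r x) (hrn : ‖r x‖ ≤ 1 / 2)
    (hg : ‖deriv r x - riccatiField η v (r x)‖ ≤ g) :
    |deriv (fun x => reflectionEnergy (a x) (b x) (r x)) x| ≤
      6 * g * reflectionEnergy (a x) (b x) (r x) := by
  set ε := deriv r x - riccatiField η v (r x)
  have h34 := three_div_four_le_one_sub_norm_sq hrn
  have hpos : 0 < 1 - ‖r x‖ ^ 2 := by linarith
  have hg0 : 0 ≤ g := (norm_nonneg _).trans hg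
  have inner_le : |inner ℝ (r x) ε| ≤ g / 2 := (abs_real_inner_le_norm _ _).trans <|
    (mul_le_mul hrn hg (norm_nonneg _) (by norm_num)).trans_eq (by ring)
  have hE : 0 ≤ reflectionEnergy (a x) (b x) (r x) := div_nonneg (by positivity) hpos.le
  have size_eq : ‖b x + r x * a x‖ ^ 2 + ‖conj (a x) + r x * conj (b x)‖ ^ 2 =
      reflectionEnergy (a x) (b x) (r x) * (1 - ‖r x‖ ^ 2) := (div_mul_cancel₀ _ hpos.ne').symm
  have coupling_le := abs_inner_add_inner_le (a := a x) (b := b x) hrn hg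
  rw [size_eq] at coupling_le
  rw [(h.hasDerivAt_reflectionEnergy (ε := ε)
    (by simpa only [ε, add_sub_cancel] using hr.hasDerivAt) hpos.ne').deriv, abs_div,
    abs_of_pos hpos, div_le_iff₀ hpos]
  refine (abs_add_le _ _).trans ?_
  rw [abs_mul, abs_mul, abs_mul, abs_two, abs_of_nonneg hE]
  nlinarith [mul_le_mul_of_nonneg_right inner_le hE, mul_nonneg hg0 hE,
    mul_le_mul_of_nonneg_left h34 (mul_nonneg hg0 hE)]

end ReflectionEnergy

section ReflectionEnergyAlongSolution

open ComplexConjugate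

theorem absolutelyContinuousOnInterval_reflectionEnergy {a b r : ℝ → ℂ} {x y : ℝ}
    (ha : AbsolutelyContinuousOnInterval a x y) (hb : AbsolutelyContinuousOnInterval b x y)
    (hr : AbsolutelyContinuousOnInterval r x y) (hrn : ∀ t ∈ uIcc x y, ‖r t‖ ≤ 1 / 2) :
    AbsolutelyContinuousOnInterval (fun t => reflectionEnergy (a t) (b t) (r t)) x y := by
  have conj_ac {f : ℝ → ℂ} (hf : AbsolutelyContinuousOnInterval f x y) :
      AbsolutelyContinuousOnInterval (fun t => conj (f t)) x y :=
    absolutelyContinuousOnInterval_comp_of_lipschitzOnWith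
      Complex.isometry_conj.lipschitz.lipschitzOnWith hf (mapsTo_univ _ _)
  have norm_ac {f : ℝ → ℂ} (hf : AbsolutelyContinuousOnInterval f x y) :
      AbsolutelyContinuousOnInterval (fun t => ‖f t‖) x y :=
    absolutelyContinuousOnInterval_comp_of_lipschitzOnWith
      lipschitzWith_one_norm.lipschitzOnWith hf (mapsTo_univ _ _)
  have contDiffOn_inv : ContDiffOn ℝ 1 (fun t : ℝ => (1 - t ^ 2)⁻¹) (Icc 0 (1 / 2)) :=
    (by fun_prop : ContDiffOn ℝ 1 (fun t : ℝ => 1 - t ^ 2) (Icc 0 (1 / 2))).inv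
      fun t ht => by nlinarith [ht.1, ht.2]
  obtain ⟨L, hL⟩ := contDiffOn_inv.exists_lipschitzOnWith (by decide) (convex_Icc 0 (1 / 2))
    isCompact_Icc
  have inv_ac := absolutelyContinuousOnInterval_comp_of_lipschitzOnWith hL (norm_ac hr)
    fun t ht => ⟨norm_nonneg _, hrn t ht⟩
  have right_ac := norm_ac (hb.fun_add (hr.fun_smul ha))
  have left_ac := norm_ac ((conj_ac ha).fun_add (hr.fun_smul (conj_ac hb)))
  simpa only [reflectionEnergy, smul_eq_mul, ← sq, ← div_eq_mul_inv] using
    ((right_ac.fun_mul right_ac).fun_add (left_ac.fun_mul left_ac)).fun_mul inv_ac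

variable {η g K : ℝ} {v : ℝ → ℝ} {u r : ℝ → ℂ}

theorem norm_riccatiField_le {v : ℝ} {r : ℂ} (hv : |v| ≤ K) (hr : ‖r‖ ≤ 1 / 2) :
    ‖riccatiField η v r‖ ≤ |η| * (1 / 2) + K * (1 + 1 / 2) ^ 2 := by
  have one_add_le : ‖1 + r‖ ≤ 1 + 1 / 2 := (norm_add_le _ _).trans (by rw [norm_one]; gcongr)
  refine (norm_add_le _ _).trans ?_
  simp only [norm_mul, norm_neg, norm_pow, Complex.norm_I, one_mul, Complex.norm_real,
    Real.norm_eq_abs]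
  have := (abs_nonneg v).trans hv
  gcongr

namespace IsApproxRiccatiSolution

variable {s t : Set ℝ}

theorem mono (h : IsApproxRiccatiSolution η v t g r) (hst : s ⊆ t) :
    IsApproxRiccatiSolution η v s g r where
  differentiableAt x hx := h.differentiableAt x (hst hx)
  norm_le x hx := h.norm_le x (hst hx)
  norm_sub_le x hx := h.norm_sub_le x (hst hx)

theorem zero (hv : ∀ x ∈ s, |v x| ≤ K) : IsApproxRiccatiSolution η v s K fun _ => 0 where
  differentiableAt _ _ := differentiableAt_const 0
  norm_le _ _ := by norm_num
  norm_sub_le x hx := by simpa [riccatiField] using hv x hx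

theorem exists_lipschitzOnWith (h : IsApproxRiccatiSolution η v s g r) (hs : Convex ℝ s)
    (hv : ∀ x ∈ s, |v x| ≤ K) : ∃ L, LipschitzOnWith L r s := by
  refine ⟨(g + (|η| * (1 / 2) + K * (1 + 1 / 2) ^ 2)).toNNReal,
    hs.lipschitzOnWith_of_nnnorm_deriv_le h.differentiableAt fun x hx => ?_⟩
  rw [← norm_toNNReal]
  refine Real.toNNReal_mono ((norm_le_norm_sub_add _ (riccatiField η (v x) (r x))).trans ?_)
  exact add_le_add (h.norm_sub_le x hx) (norm_riccatiField_le (hv x hx) (h.norm_le x hx))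

end IsApproxRiccatiSolution

/-- The amplitude `u' + iηu/2`, which is constant up to the phase `e^{iηx/2}` when
`u'' = -(η²/4)u`. -/
noncomputable def solutionAmplitude (η : ℝ) (u : ℝ → ℂ) (x : ℝ) : ℂ :=
  deriv u x + Complex.I * (η / 2) * u x

theorem sq_mul_norm_sq_add_le_reflectionEnergy (u : ℝ → ℂ) (x : ℝ) {r : ℂ} (hr : ‖r‖ ≤ 1 / 2) :
    η ^ 2 * ‖u x‖ ^ 2 + 4 * ‖deriv u x‖ ^ 2 ≤
      8 * reflectionEnergy (solutionAmplitude η u x) (solutionAmplitude (-η) u x) r := by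
  have parallelogram := parallelogram_law_with_norm ℝ (deriv u x) (Complex.I * (η / 2) * u x)
  have norm_eq : ‖Complex.I * (η / 2) * u x‖ ^ 2 = η ^ 2 / 4 * ‖u x‖ ^ 2 := by
    simp only [norm_mul, norm_div, mul_pow, div_pow, Complex.norm_I, Complex.norm_real,
      Complex.norm_ofNat, Real.norm_eq_abs, sq_abs]
    ring
  have minus_eq : solutionAmplitude (-η) u x = deriv u x - Complex.I * (η / 2) * u x := by
    simp only [solutionAmplitude, Complex.ofReal_neg]
    ring
  have energy_ge := sq_add_sq_le_reflectionEnergy (a := solutionAmplitude η u x)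
    (b := solutionAmplitude (-η) u x) hr
  rw [minus_eq] at energy_ge ⊢
  rw [solutionAmplitude] at energy_ge ⊢
  linarith

namespace IsSchrodingerSolution

theorem absolutelyContinuousOnInterval_solutionAmplitude {V : ℝ → ℝ} {E : ℝ}
    (hu : IsSchrodingerSolution V E u) (η : ℝ) {x y : ℝ} (hx : 0 < x) (hy : 0 < y) :
    AbsolutelyContinuousOnInterval (solutionAmplitude η u) x y := by
  have of_le {x y : ℝ} (hx : 0 < x) (hxy : x ≤ y) :
      AbsolutelyContinuousOnInterval (solutionAmplitude η u) x y :=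
    (hu.locallyAC_deriv x y hx hxy).fun_add
      ((hu.locallyAC x y hx hxy).const_smul (Complex.I * (η / 2)))
  rcases le_total x y with hxy | hyx
  · exact of_le hx hxy
  · exact (of_le hy hyx).symm

theorem ae_isAmplitudePairAt (hu : IsSchrodingerSolution (fun x => η * v x) (η ^ 2 / 4) u) :
    ∀ᵐ x ∂volume.restrict (Ioi 0),
      IsAmplitudePairAt η (v x) (solutionAmplitude η u) (solutionAmplitude (-η) u) x := by
  filter_upwards [hu.equation, ae_restrict_mem measurableSet_Ioi] with x hx hpos
  have hasDerivAt (η : ℝ) := hx.1.hasDerivAt.add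
    ((hu.differentiableAt x hpos).hasDerivAt.const_mul (Complex.I * (η / 2)))
  have equation := hx.2
  push_cast at equation
  refine ⟨(hasDerivAt η).congr_deriv ?_, (hasDerivAt (-η)).congr_deriv ?_⟩ <;>
  · simp only [amplitudeField, solutionAmplitude, Complex.ofReal_neg]
    linear_combination -equation - (η ^ 2 / 4 - η * v x) * u x * Complex.I_sq

theorem reflectionEnergy_le (hu : IsSchrodingerSolution (fun x => η * v x) (η ^ 2 / 4) u)
    {x y : ℝ} (hx : 0 < x) (hy : 0 < y) (hr : IsApproxRiccatiSolution η v (uIcc x y) g r)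
    (hv : ∀ t ∈ uIcc x y, |v t| ≤ K) :
    reflectionEnergy (solutionAmplitude η u y) (solutionAmplitude (-η) u y) (r y) ≤
      reflectionEnergy (solutionAmplitude η u x) (solutionAmplitude (-η) u x) (r x) *
        Real.exp (6 * g * |y - x|) := by
  obtain ⟨L, hL⟩ := hr.exists_lipschitzOnWith (convex_uIcc x y) hv
  have energy_ac := absolutelyContinuousOnInterval_reflectionEnergy
    (hu.absolutelyContinuousOnInterval_solutionAmplitude η hx hy)
    (hu.absolutelyContinuousOnInterval_solutionAmplitude (-η) hx hy)
    hL.absolutelyContinuousOnInterval hr.norm_le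
  refine le_mul_exp_of_ae_abs_deriv_le energy_ac ?_
  have subset_Ioi : uIcc x y ⊆ Ioi 0 := fun t ht => (lt_min hx hy).trans_le ht.1
  filter_upwards [ae_restrict_of_ae_restrict_of_subset subset_Ioi hu.ae_isAmplitudePairAt,
    ae_restrict_mem measurableSet_uIcc] with t ht hmem
  exact ht.abs_deriv_reflectionEnergy_le (hr.differentiableAt t hmem) (hr.norm_le t hmem)
    (hr.norm_sub_le t hmem)

end IsSchrodingerSolution

end ReflectionEnergyAlongSolution

section Boundedness

theorem exists_eventually_mul_exp_le {F g : ℕ → ℝ} (hg : Summable g)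
    (hF : ∀ᶠ n in Filter.atTop, F (n + 1) ≤ F n * Real.exp (g n)) :
    ∃ C, ∀ᶠ n in Filter.atTop, F n * Real.exp (g n) ≤ C := by
  obtain ⟨N, hN⟩ := Filter.eventually_atTop.1 hF
  set G : ℕ → ℝ := fun n => ∑ i ∈ Finset.range n, g i
  have mul_exp_le (n : ℕ) (hn : N ≤ n) :
      F n * Real.exp (g n) ≤ F N * Real.exp (G (n + 1) - G N) := by
    induction n, hn using Nat.le_induction with
    | base => simp only [G, Finset.sum_range_succ, add_sub_cancel_left, le_refl]
    | succ n hn ih =>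
      calc F (n + 1) * Real.exp (g (n + 1))
          ≤ F N * Real.exp (G (n + 1) - G N) * Real.exp (g (n + 1)) := by
            gcongr
            exact (hN n hn).trans ih
        _ = F N * Real.exp (G (n + 1 + 1) - G N) := by
            rw [mul_assoc, ← Real.exp_add, sub_add_eq_add_sub, ← Finset.sum_range_succ]
  have tendsto : Filter.Tendsto (fun n => F N * Real.exp (G (n + 1) - G N)) Filter.atTop
      (nhds (F N * Real.exp (∑' i, g i - G N))) :=
    (((hg.hasSum.tendsto_sum_nat.comp (Filter.tendsto_add_atTop_nat 1)).sub_const _).rexp).const_mul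
      _
  obtain ⟨C, hC⟩ := tendsto.bddAbove_range
  exact ⟨C, Filter.eventually_atTop.2
    ⟨N, fun n hn => (mul_exp_le n hn).trans (hC (mem_range_self n))⟩⟩

namespace IsSchrodingerSolution

variable {η K : ℝ} {v : ℝ → ℝ} {u : ℝ → ℂ} {r : ℕ → ℝ → ℂ} {g : ℕ → ℝ}

theorem exists_bound_near_zero (hu : IsSchrodingerSolution (fun x => η * v x) (η ^ 2 / 4) u)
    (hv : ∀ x, 0 < x → |v x| ≤ K) {a : ℝ} (ha : 0 < a) :
    ∃ C, ∀ x ∈ Ioc 0 a, η ^ 2 * ‖u x‖ ^ 2 + 4 * ‖deriv u x‖ ^ 2 ≤ C := by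
  set E : ℝ → ℝ := fun x =>
    reflectionEnergy (solutionAmplitude η u x) (solutionAmplitude (-η) u x) 0
  have le_energy (x : ℝ) : η ^ 2 * ‖u x‖ ^ 2 + 4 * ‖deriv u x‖ ^ 2 ≤ 8 * E x :=
    sq_mul_norm_sq_add_le_reflectionEnergy u x (by norm_num)
  refine ⟨8 * (E a * Real.exp (6 * K * a)), fun x hx => (le_energy x).trans ?_⟩
  have hvx (t : ℝ) (ht : t ∈ uIcc a x) : |v t| ≤ K := hv t ((lt_min ha hx.1).trans_le ht.1)
  have energy_nonneg : 0 ≤ E a := by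
    have : 0 ≤ η ^ 2 * ‖u a‖ ^ 2 + 4 * ‖deriv u a‖ ^ 2 := by positivity
    linarith [le_energy a]
  have K_nonneg : 0 ≤ K := (abs_nonneg _).trans (hv a ha)
  gcongr
  refine (hu.reflectionEnergy_le ha hx.1 (.zero hvx) hvx).trans ?_
  gcongr
  rw [abs_sub_comm, abs_of_nonneg (sub_nonneg.2 hx.2)]
  linarith [hx.1]

theorem reflectionEnergy_le_of_mem_Icc
    (hu : IsSchrodingerSolution (fun x => η * v x) (η ^ 2 / 4) u)
    (hv : ∀ x, 0 < x → |v x| ≤ K) {n : ℕ} {r : ℝ → ℂ} {g : ℝ}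
    (hr : IsApproxRiccatiSolution η v (Icc (n + 1) (n + 2)) g r) {x : ℝ}
    (hx : x ∈ Icc (n + 1 : ℝ) (n + 2)) :
    reflectionEnergy (solutionAmplitude η u x) (solutionAmplitude (-η) u x) (r x) ≤
      reflectionEnergy (solutionAmplitude η u (n + 1)) (solutionAmplitude (-η) u (n + 1))
        (r (n + 1)) * Real.exp (6 * g) := by
  have left_mem : (n + 1 : ℝ) ∈ Icc (n + 1 : ℝ) (n + 2) := ⟨le_rfl, by linarith⟩
  have subset_Icc : uIcc (n + 1 : ℝ) x ⊆ Icc (n + 1) (n + 2) :=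
    ordConnected_Icc.uIcc_subset left_mem hx
  refine (hu.reflectionEnergy_le (Icc_add_one_subset_Ioi n left_mem) (Icc_add_one_subset_Ioi n hx)
    (hr.mono subset_Icc) fun t ht => hv t (Icc_add_one_subset_Ioi n (subset_Icc ht))).trans ?_
  have g_nonneg : 0 ≤ g := (norm_nonneg _).trans (hr.norm_sub_le _ left_mem)
  have energy_nonneg := (by positivity : (0 : ℝ) ≤ _).trans
    (sq_mul_norm_sq_add_le_reflectionEnergy (η := η) u (n + 1) (hr.norm_le _ left_mem))
  refine mul_le_mul_of_nonneg_left (Real.exp_le_exp.2 ?_) (by linarith)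
  refine mul_le_of_le_one_right (by positivity) (abs_le.2 ⟨?_, ?_⟩) <;> linarith [hx.1, hx.2]

theorem exists_eventually_bound (hu : IsSchrodingerSolution (fun x => η * v x) (η ^ 2 / 4) u)
    (hv : ∀ x, 0 < x → |v x| ≤ K) (hg : Summable g) (hglue : ∀ n, r (n + 1) (n + 2) = r n (n + 2))
    (hr : ∀ᶠ n : ℕ in Filter.atTop,
      IsApproxRiccatiSolution η v (Icc (n + 1) (n + 2)) (g n) (r n)) :
    ∃ C, ∀ᶠ n : ℕ in Filter.atTop, ∀ x ∈ Icc (n + 1 : ℝ) (n + 2),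
      η ^ 2 * ‖u x‖ ^ 2 + 4 * ‖deriv u x‖ ^ 2 ≤ C := by
  set E : ℕ → ℝ → ℝ := fun n x =>
    reflectionEnergy (solutionAmplitude η u x) (solutionAmplitude (-η) u x) (r n x)
  have glue (n : ℕ) : E (n + 1) ((n + 1 : ℕ) + 1) = E n (n + 2) := by
    rw [Nat.cast_succ, add_assoc, one_add_one_eq_two]
    simp only [E, hglue]
  have growth : ∀ᶠ n in Filter.atTop,
      E (n + 1) ((n + 1 : ℕ) + 1) ≤ E n (n + 1) * Real.exp (6 * g n) := by
    filter_upwards [hr] with n hn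
    rw [glue]
    exact hu.reflectionEnergy_le_of_mem_Icc hv hn ⟨by linarith, le_rfl⟩
  obtain ⟨C, hC⟩ := exists_eventually_mul_exp_le (F := fun n => E n (n + 1)) (hg.mul_left 6) growth
  refine ⟨8 * C, ?_⟩
  filter_upwards [hr, hC] with n hn hnC x hx
  refine (sq_mul_norm_sq_add_le_reflectionEnergy u x (hn.norm_le x hx)).trans ?_
  exact mul_le_mul_of_nonneg_left ((hu.reflectionEnergy_le_of_mem_Icc hv hn hx).trans hnC)
    (by norm_num)

theorem exists_bound_of_isApproxRiccatiSolution
    (hu : IsSchrodingerSolution (fun x => η * v x) (η ^ 2 / 4) u)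
    (hv : ∀ x, 0 < x → |v x| ≤ K) (hg : Summable g) (hglue : ∀ n, r (n + 1) (n + 2) = r n (n + 2))
    (hr : ∀ᶠ n : ℕ in Filter.atTop,
      IsApproxRiccatiSolution η v (Icc (n + 1) (n + 2)) (g n) (r n)) :
    ∃ C, ∀ x, 0 < x → η ^ 2 * ‖u x‖ ^ 2 + 4 * ‖deriv u x‖ ^ 2 ≤ C := by
  obtain ⟨C, hC⟩ := hu.exists_eventually_bound hv hg hglue hr
  obtain ⟨N, hN⟩ := Filter.eventually_atTop.1 hC
  obtain ⟨C₀, hC₀⟩ := hu.exists_bound_near_zero hv (a := N + 1) (by positivity)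
  refine ⟨max C₀ C, fun x hx => ?_⟩
  rcases le_total x (N + 1) with hxN | hNx
  · exact (hC₀ x ⟨hx, hxN⟩).trans (le_max_left _ _)
  · have N_le : (N : ℝ) ≤ x - 1 := by linarith
    have floor_le := Nat.floor_le ((Nat.cast_nonneg N).trans N_le)
    have lt_floor := Nat.lt_floor_add_one (x - 1)
    exact (hN ⌊x - 1⌋₊ (Nat.le_floor N_le) x ⟨by linarith, by linarith⟩).trans (le_max_right _ _)

end IsSchrodingerSolution

end Boundedness

namespace SmallDivisorCondition

variable {c : ℕ → ℂ} {φ : ℕ → ℝ} {η : ℝ} {j : ℕ}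

theorem const_mul (h : SmallDivisorCondition c φ η j) (a : ℂ) :
    SmallDivisorCondition (fun k => a * c k) φ η j := by
  refine ⟨fun k hk => h.1 k fun i => right_ne_zero_of_mul (hk i),
    (h.2.mul_left (‖a‖ ^ j)).congr fun k => ?_⟩
  rw [Finset.prod_mul_distrib, Finset.prod_const, Finset.card_univ, Fintype.card_fin, mul_assoc,
    norm_mul (a ^ j), norm_pow]

theorem zero (hη : η ≠ 0) : SmallDivisorCondition c φ η 0 :=
  ⟨fun _ _ => by simpa using hη, (hasSum_fintype _).summable⟩

end SmallDivisorCondition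

theorem lemma1p3_general
    (V : ℝ → ℝ) (c : ℕ → ℂ) (φ : ℕ → ℝ) (γ : ℕ → ℝ → ℂ) (p : ℕ) (hp : 1 ≤ p)
    (η : ℝ) (hη : η ≠ 0)
    (hV : ∀ x : ℝ, 0 < x →
      HasSum (fun k => c k * Complex.exp (-Complex.I * (φ k : ℂ) * (x : ℂ)) * γ k x) (V x : ℂ))
    (hvar : ⨆ k, eVariationOn (γ k) (Ioi 0) < ∞)
    (hLp : ∫⁻ x in Ioi (0 : ℝ), (⨆ k, ‖γ k x‖ₑ) ^ p < ∞)
    (hc : Summable fun k => ‖c k‖)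
    (hsmall : ∀ j : ℕ, 1 ≤ j → j ≤ p - 1 → SmallDivisorCondition c φ η j)
    (u : ℝ → ℂ) (hu : IsSchrodingerSolution V (η ^ 2 / 4) u) :
    ∃ C : ℝ, ∀ x : ℝ, 0 < x → ‖u x‖ ≤ C ∧ ‖deriv u x‖ ≤ C := by
  obtain ⟨q, rfl⟩ : ∃ q, p = q + 1 := ⟨p - 1, by omega⟩
  have hcond (j : ℕ) (hj : j ≤ q) : SmallDivisorCondition (fun k => (η : ℂ)⁻¹ * c k) φ η j := by
    rcases Nat.eq_zero_or_pos j with rfl | hpos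
    · exact .zero hη
    · exact (hsmall j hpos (by omega)).const_mul _
  have hc' : Summable fun k => ‖(η : ℂ)⁻¹ * c k‖ := by
    simpa only [norm_mul] using hc.mul_left ‖(η : ℂ)⁻¹‖
  have hv (x : ℝ) (hx : 0 < x) : HasSum (oscTerm (fun k => (η : ℂ)⁻¹ * c k) φ (fun k => γ k x) x)
      ((η⁻¹ * V x : ℝ) : ℂ) := by
    rw [Complex.ofReal_mul, Complex.ofReal_inv]
    exact hasSum_oscTerm_const_mul (hV x hx) _
  have hu' : IsSchrodingerSolution (fun x => η * (η⁻¹ * V x)) (η ^ 2 / 4) u := by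
    simpa only [mul_inv_cancel_left₀ hη] using hu
  obtain ⟨r, g, hg, hglue, hr⟩ := exists_isApproxRiccatiSolution
    (fun j hj => (hcond (j + 1) hj).1) hc' (fun j hj => (hcond j hj).2) hv hvar hLp
  obtain ⟨B, hB⟩ := hu'.exists_bound_of_isApproxRiccatiSolution
    (fun x hx => abs_le_of_hasSum_oscTerm (hv x hx) hc'
      fun k => norm_le_of_variation_of_lintegral hvar hLp k hx) hg hglue hr
  refine ⟨max √(B / η ^ 2) √(B / 4), fun x hx => ⟨le_max_of_le_left ?_, le_max_of_le_right ?_⟩⟩ <;>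
  · refine Real.le_sqrt_of_sq_le ((le_div_iff₀' (by positivity)).2 ?_)
    nlinarith [hB x hx, mul_nonneg (sq_nonneg η) (sq_nonneg ‖u x‖), sq_nonneg ‖deriv u x‖]

theorem lemma1p3
    (V : ℝ → ℝ) (c : ℕ → ℂ) (φ : ℕ → ℝ) (γ : ℕ → ℝ → ℂ) (p : ℕ) (hp : 2 ≤ p)
    (η : ℝ) (hη : 0 < η)
    -- the potential
    (hV : ∀ x : ℝ, 0 < x →
      HasSum (fun k => c k * Complex.exp (-Complex.I * (φ k : ℂ) * (x : ℂ)) * γ k x) (V x : ℂ))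
    -- uniformly bounded variation
    (hvar : ⨆ k, eVariationOn (γ k) (Ioi 0) < ∞)
    -- uniform `L^p` condition
    (hLp : ∫⁻ x in Ioi (0 : ℝ), (⨆ k, ‖γ k x‖ₑ) ^ p < ∞)
    -- decay of coefficients
    (hc : Summable fun k => ‖c k‖)
    -- small divisor conditions
    (hsmall : ∀ j : ℕ, 1 ≤ j → j ≤ p - 1 → SmallDivisorCondition c φ η j)
    (u : ℝ → ℂ) (hu : IsSchrodingerSolution V (η ^ 2 / 4) u) :
    ∃ C : ℝ, ∀ x : ℝ, 0 < x → ‖u x‖ ≤ C := by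
  obtain ⟨C, hC⟩ :=
    lemma1p3_general V c φ γ p (by omega) η hη.ne' hV hvar hLp hc hsmall u hu
  exact ⟨C, fun x hx => (hC x hx).1⟩
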